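/- **Theorem (Online Stripe Discrepancy).** Suppose $n$ points $p_1,\dots,p_n$ arrive one by one, independently and uniformly at random in the unit square $[0,1]\times[0,1]$. On its arrival each point has to be coloured immediately and irrevocably: the algorithm knows $n$ and the points that have arrived so far and chooses $\chi(t)\in\{-1,+1\}$ for $p_t$. Let $\mathcal S$ consist of all stripes $[a,b]\times[0,1]$ and $[0,1]\times[a,b]$ with $0\le a<b\le 1$, and let $$\mathsf{disc}\;=\;\sup_{S\in\mathcal S}\Big|\sum_{t\,:\,p_t\in S}\chi(t)\Big| .$$ There are a deterministic online algorithm and a universal constant $c>0$ with the following properties. The algorithm is efficient: it is a single program, for all $n$, of a random-access machine over the natural numbers that reads the binary digits of the coordinates of each arriving point, and its total running time (logarithmic cost) on any $n$ points is at most a fixed polynomial in $n$. With high probability its discrepancy is $O(n^{c/\log\log n})$: for every $k\in\mathbb N$ there is a constant $C>0$, depending only on $k$, such that for all $n\ge 3$ $$\Pr\Big[\mathsf{disc}> C\,n^{c/\log\log n}\Big]\;\le\;\frac1{n^{k}} .$$ -/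

import Mathlib

open MeasureTheory Set

/-- Memory of a random-access machine: registers and arrays holding natural numbers, together with
two one-way input tapes carrying the not yet read binary digits of the two coordinates of the
current point. -/
structure RamState where
  reg : ℕ → ℕ
  arr : ℕ → ℕ → ℕ
  tapeX : ℕ → Fin 2
  tapeY : ℕ → Fin 2

/-- Programs of the random-access machine. Registers and arrays are named by fixed numbers, array
cells are addressed by the contents of a register. The only iteration is `loop r P`, which runs `P`
as many times as the value of register `r` on entry; so every program halts on every input. These
are special random-access machine programs, so the existence of one is the stronger claim. -/
inductive RamProg where
  | skip : RamProg
  | const (r c : ℕ) : RamProg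
  | copy (r s : ℕ) : RamProg
  | add (r s t : ℕ) : RamProg
  | sub (r s t : ℕ) : RamProg
  | mul (r s t : ℕ) : RamProg
  | div (r s t : ℕ) : RamProg
  | load (r a i : ℕ) : RamProg
  | store (a i r : ℕ) : RamProg
  | readX (r : ℕ) : RamProg
  | readY (r : ℕ) : RamProg
  | seq (P Q : RamProg) : RamProg
  | ifLt (r s : ℕ) (P Q : RamProg) : RamProg
  | loop (r : ℕ) (P : RamProg) : RamProg

namespace RamState

/-- Overwrite register `r`. -/
def setReg (s : RamState) (r v : ℕ) : RamState :=
  { s with reg := Function.update s.reg r v }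

/-- Overwrite cell `i` of array `a`. -/
def setArr (s : RamState) (a i v : ℕ) : RamState :=
  { s with arr := Function.update s.arr a (Function.update (s.arr a) i v) }

end RamState

namespace RamProg

/-- The state in which a program halts. -/
def exec : RamProg → RamState → RamState
  | skip, σ => σ
  | const r c, σ => σ.setReg r c
  | copy r s, σ => σ.setReg r (σ.reg s)
  | add r s t, σ => σ.setReg r (σ.reg s + σ.reg t)
  | sub r s t, σ => σ.setReg r (σ.reg s - σ.reg t)
  | mul r s t, σ => σ.setReg r (σ.reg s * σ.reg t)
  | div r s t, σ => σ.setReg r (σ.reg s / σ.reg t)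
  | load r a i, σ => σ.setReg r (σ.arr a (σ.reg i))
  | store a i r, σ => σ.setArr a (σ.reg i) (σ.reg r)
  | readX r, σ => { σ.setReg r (σ.tapeX 0) with tapeX := fun j => σ.tapeX (j + 1) }
  | readY r, σ => { σ.setReg r (σ.tapeY 0) with tapeY := fun j => σ.tapeY (j + 1) }
  | seq P Q, σ => exec Q (exec P σ)
  | ifLt r s P Q, σ => if σ.reg r < σ.reg s then exec P σ else exec Q σ
  | loop r P, σ => (exec P)^[σ.reg r] σ

/-- The running time of a program under the logarithmic cost criterion: every elementary operation
is charged one unit plus the binary lengths of the numbers and addresses that it handles. -/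
def time : RamProg → RamState → ℕ
  | skip, _ => 1
  | const _ c, _ => 1 + c.size
  | copy _ s, σ => 1 + (σ.reg s).size
  | add _ s t, σ => 1 + (σ.reg s).size + (σ.reg t).size
  | sub _ s t, σ => 1 + (σ.reg s).size + (σ.reg t).size
  | mul _ s t, σ => 1 + (σ.reg s).size + (σ.reg t).size
  | div _ s t, σ => 1 + (σ.reg s).size + (σ.reg t).size
  | load _ a i, σ => 1 + (σ.reg i).size + (σ.arr a (σ.reg i)).size
  | store _ i r, σ => 1 + (σ.reg i).size + (σ.reg r).size
  | readX _, _ => 1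
  | readY _, _ => 1
  | seq P Q, σ => time P σ + time Q (exec P σ)
  | ifLt r s P Q, σ =>
      1 + (σ.reg r).size + (σ.reg s).size + if σ.reg r < σ.reg s then time P σ else time Q σ
  | loop r P, σ =>
      1 + (σ.reg r).size +
        ∑ i ∈ Finset.range (σ.reg r), (1 + (σ.reg r).size + time P ((exec P)^[i] σ))

end RamProg

/-- A deterministic uniform online algorithm for colouring points of the plane: `init` is run once,
knowing only the number `n` of points; `step` is run on each arrival. -/
structure OnlineAlg where
  init : RamProg
  step : RamProg

namespace OnlineAlg

/-- The memory before anything is run: register `0` holds `n`, everything else is zero. -/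
def start (n : ℕ) : RamState where
  reg := fun r => if r = 0 then n else 0
  arr := fun _ _ => 0
  tapeX := fun _ => 0
  tapeY := fun _ => 0

/-- Arrival of the point `z`: the input tapes now carry the binary digits (after the point) of the
two coordinates of `z`; the rest of the memory is kept. -/
noncomputable def feed (z : ℝ × ℝ) (σ : RamState) : RamState :=
  { σ with tapeX := Real.digits z.1 2, tapeY := Real.digits z.2 2 }

/-- The memory after the points of the list `l` have arrived in this order, when `n` points are
announced. -/
noncomputable def stateAfter (A : OnlineAlg) (n : ℕ) (l : List (ℝ × ℝ)) : RamState :=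
  l.foldl (fun σ z => A.step.exec (feed z σ)) (A.init.exec (start n))

/-- The colour given to the `t`-th point (counted from `0`). It is read off register `1` right after
the `t`-th arrival has been processed, so it depends only on the points that have arrived. -/
noncomputable def color (A : OnlineAlg) {n : ℕ} (p : Fin n → ℝ × ℝ) (t : Fin n) : ℤ :=
  if (A.stateAfter n ((List.ofFn p).take (t + 1))).reg 1 = 0 then -1 else 1

/-- The total running time on the points `p 0, …, p (n - 1)`. -/
noncomputable def runTime (A : OnlineAlg) {n : ℕ} (p : Fin n → ℝ × ℝ) : ℕ :=
  A.init.time (start n) +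
    ∑ t : Fin n, A.step.time (feed (p t) (A.stateAfter n ((List.ofFn p).take t)))

/-- The total running time is at most polynomial in the number of points, on every input. -/
def IsPolyTime (A : OnlineAlg) : Prop :=
  ∃ q : Polynomial ℕ, ∀ (n : ℕ) (p : Fin n → ℝ × ℝ), A.runTime p ≤ q.eval n

end OnlineAlg

/-- The vertical and horizontal stripes of the unit square. -/
def stripes : Set (Set (ℝ × ℝ)) :=
  {S | ∃ a b : ℝ, 0 ≤ a ∧ a < b ∧ b ≤ 1 ∧
    (S = Icc a b ×ˢ Icc 0 1 ∨ S = Icc 0 1 ×ˢ Icc a b)}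

open scoped Classical in
/-- The imbalance of a set `S` under the colouring `χ` of the points `p`. -/
noncomputable def imbalance {n : ℕ} (p : Fin n → ℝ × ℝ) (χ : Fin n → ℤ) (S : Set (ℝ × ℝ)) : ℤ :=
  ∑ t : Fin n, if p t ∈ S then χ t else 0

/-- The discrepancy of the colouring `χ` of the points `p` with respect to all stripes. -/
noncomputable def stripeDisc {n : ℕ} (p : Fin n → ℝ × ℝ) (χ : Fin n → ℤ) : ℝ :=
  ⨆ S : stripes, |(imbalance p χ S : ℝ)|

/-- The supremum in `stripeDisc` is over a bounded set. -/
theorem bddAbove_imbalance {n : ℕ} (p : Fin n → ℝ × ℝ) (χ : Fin n → ℤ) :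
    BddAbove (range fun S : stripes => |(imbalance p χ S : ℝ)|) := by
  refine ⟨∑ t, |(χ t : ℝ)|, ?_⟩
  rintro _ ⟨S, rfl⟩
  simp only [imbalance]
  push_cast
  refine (Finset.abs_sum_le_sum_abs _ _).trans (Finset.sum_le_sum fun t _ => ?_)
  split_ifs <;> simp

/-- The law of `n` independent uniform points of the unit square. -/
noncomputable def uniformPoints (n : ℕ) : Measure (Fin n → ℝ × ℝ) :=
  Measure.pi fun _ => (volume : Measure (ℝ × ℝ)).restrict (Icc 0 1 ×ˢ Icc 0 1)

/-!
Cut the square into `2 ^ m` columns and `2 ^ m` rows, where `2 ^ m` is about `n`. Each point has a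
sparse vector of Haar coefficients: for every level of the two dyadic trees one entry `±1` (plus the
constant function). A colour is chosen greedily, so that the first-order term of the potential
`Φ = ∑ v, (r ^ d v + r ^ (-d v))` with `r = 1 + 1 / m` does not increase, where `d` is the signed
sum of the vectors so far. The Haar functions are orthogonal, so pairing the first-order term
with the signs of the slopes shows that on average over the next point it gains at least a
`1 / (2 m + 1)` fraction of `∑ v, |r ^ d v - r ^ (-d v)|` over the entries that the point touches.
This pays for the second-order term up to `O(1)`, so `E Φ` grows linearly and Markov's inequality
bounds all `d v` by `O(m ^ 2)` with high probability. A dyadic prefix sum is a combination of `m`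
Haar coefficients with weights at most one; a stripe is a difference of two of them up to two
boundary columns or rows, which hold `O(m)` points by a union bound over sets of points. Hence the
discrepancy is `O((log n) ^ 3)`. Multiplying the slopes by `(m * (m + 1)) ^ n` makes the greedy rule
a comparison of integers with polynomially many digits.
-/

theorem size_le_self (x : ℕ) : x.size ≤ x := Nat.size_le.2 Nat.lt_two_pow_self

theorem size_add_le {x y s : ℕ} (hx : x.size ≤ s) (hy : y.size ≤ s) : (x + y).size ≤ s + 1 := by
  rw [Nat.size_le] at *
  rw [pow_succ]
  omega

theorem size_mul_le {x y s t : ℕ} (hx : x.size ≤ s) (hy : y.size ≤ t) :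
    (x * y).size ≤ s + t := by
  rw [Nat.size_le] at *
  rw [pow_add]
  exact Nat.mul_lt_mul'' hx hy

namespace RamState

/-- All numbers in the memory have at most `s` binary digits. -/
def SizeLE (σ : RamState) (s : ℕ) : Prop :=
  (∀ r, (σ.reg r).size ≤ s) ∧ ∀ a i, (σ.arr a i).size ≤ s

namespace SizeLE

variable {σ : RamState} {s t v : ℕ}

theorem mono (h : σ.SizeLE s) (hst : s ≤ t) : σ.SizeLE t :=
  ⟨fun r => (h.1 r).trans hst, fun a i => (h.2 a i).trans hst⟩

theorem setReg (h : σ.SizeLE s) (r : ℕ) (hst : s ≤ t) (hv : v.size ≤ t) :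
    (σ.setReg r v).SizeLE t := by
  refine ⟨fun q => ?_, (h.mono hst).2⟩
  simp only [RamState.setReg, Function.update_apply]
  split_ifs
  exacts [hv, (h.mono hst).1 q]

theorem setArr (h : σ.SizeLE s) (a i : ℕ) (hst : s ≤ t) (hv : v.size ≤ t) :
    (σ.setArr a i v).SizeLE t := by
  refine ⟨(h.mono hst).1, fun b j => ?_⟩
  simp only [RamState.setArr, Function.update_apply]
  split_ifs with hb
  · simp only [Function.update_apply]
    split_ifs
    exacts [hv, (h.mono hst).2 a j]
  · exact (h.mono hst).2 b j

end SizeLE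

end RamState

namespace RamProg

/-- The registers that a program may overwrite. -/
def writes : RamProg → Finset ℕ
  | skip => ∅
  | const r _ => {r}
  | copy r _ => {r}
  | add r _ _ => {r}
  | sub r _ _ => {r}
  | mul r _ _ => {r}
  | div r _ _ => {r}
  | load r _ _ => {r}
  | store _ _ _ => ∅
  | readX r => {r}
  | readY r => {r}
  | seq P Q => P.writes ∪ Q.writes
  | ifLt _ _ P Q => P.writes ∪ Q.writes
  | loop _ P => P.writes

/-- The arrays that a program may modify. -/
def stores : RamProg → Finset ℕ
  | store a _ _ => {a}
  | seq P Q => P.stores ∪ Q.stores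
  | ifLt _ _ P Q => P.stores ∪ Q.stores
  | loop _ P => P.stores
  | _ => ∅

/-- Every loop counter and the right factor of every multiplication is a register of `R`. If the
program never overwrites `R`, the contents of `R` on entry therefore bound both the number of
operations and the growth of the binary lengths, as made precise by `cost`. -/
def GuardedBy (R : Finset ℕ) : RamProg → Prop
  | mul _ _ t => t ∈ R
  | seq P Q => P.GuardedBy R ∧ Q.GuardedBy R
  | ifLt _ _ P Q => P.GuardedBy R ∧ Q.GuardedBy R
  | loop r P => r ∈ R ∧ P.GuardedBy R
  | _ => True

/-- A bound for the number of operations and for the growth of the binary lengths, as a polynomial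
in a bound for the contents of the guarding registers. -/
noncomputable def cost : RamProg → Polynomial ℕ
  | const _ c => 1 + Polynomial.C c.size
  | mul _ _ _ => 1 + Polynomial.X
  | seq P Q => P.cost + Q.cost
  | ifLt _ _ P Q => 1 + P.cost + Q.cost
  | loop _ P => 1 + Polynomial.X * (1 + P.cost)
  | _ => 1

theorem exec_reg_of_notMem_writes {P : RamProg} {r : ℕ} (h : r ∉ P.writes) (σ : RamState) :
    (P.exec σ).reg r = σ.reg r := by
  induction P generalizing σ with
  | seq P Q ihP ihQ =>
    simp only [writes, Finset.mem_union, not_or] at h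
    simp only [exec, ihQ h.2, ihP h.1]
  | ifLt a b P Q ihP ihQ =>
    simp only [writes, Finset.mem_union, not_or] at h
    simp only [exec]
    split_ifs
    exacts [ihP h.1 σ, ihQ h.2 σ]
  | loop a P ih =>
    simp only [exec]
    generalize σ.reg a = k
    induction k with
    | zero => rfl
    | succ k ihk => rw [Function.iterate_succ_apply', ih h, ihk]
  | skip => rfl
  | store => rfl
  | _ => simp_all [writes, exec, RamState.setReg]

theorem exec_arr_of_notMem_stores {P : RamProg} {a : ℕ} (h : a ∉ P.stores) (σ : RamState) :
    (P.exec σ).arr a = σ.arr a := by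
  induction P generalizing σ with
  | seq P Q ihP ihQ =>
    simp only [stores, Finset.mem_union, not_or] at h
    simp only [exec, ihQ h.2, ihP h.1]
  | ifLt a b P Q ihP ihQ =>
    simp only [stores, Finset.mem_union, not_or] at h
    simp only [exec]
    split_ifs
    exacts [ihP h.1 σ, ihQ h.2 σ]
  | loop b P ih =>
    simp only [exec]
    generalize σ.reg b = k
    induction k with
    | zero => rfl
    | succ k ihk => rw [Function.iterate_succ_apply', ih h, ihk]
  | store => simp_all [stores, exec, RamState.setArr]
  | _ => rfl

theorem iterate_exec_reg_of_notMem_writes {P : RamProg} {r : ℕ} (h : r ∉ P.writes) (k : ℕ)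
    (σ : RamState) : ((exec P)^[k] σ).reg r = σ.reg r := by
  induction k with
  | zero => rfl
  | succ k ih => rw [Function.iterate_succ_apply', exec_reg_of_notMem_writes h, ih]

theorem iterate_exec_arr_of_notMem_stores {P : RamProg} {a : ℕ} (h : a ∉ P.stores) (k : ℕ)
    (σ : RamState) : ((exec P)^[k] σ).arr a = σ.arr a := by
  induction k with
  | zero => rfl
  | succ k ih => rw [Function.iterate_succ_apply', exec_arr_of_notMem_stores h, ih]

/-- Started in the state `σ` with numbers of at most `s` binary digits, `P` performs at most `c`
operations and lengthens the numbers by at most `c` digits. -/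
def RunsWithin (P : RamProg) (σ : RamState) (s c : ℕ) : Prop :=
  (P.exec σ).SizeLE (s + c) ∧ P.time σ ≤ c * (1 + 2 * (s + c))

section RunsWithin

variable {P Q : RamProg} {σ : RamState} {s c d q r b : ℕ}

theorem RunsWithin.of_time_le (hsize : (P.exec σ).SizeLE (s + c))
    (htime : P.time σ ≤ c + 2 * s) (hc : 1 ≤ c) : RunsWithin P σ s c :=
  ⟨hsize, by nlinarith⟩

theorem RunsWithin.seq (hP : RunsWithin P σ s c) (hQ : RunsWithin Q (P.exec σ) (s + c) d) :
    RunsWithin (P.seq Q) σ s (c + d) := by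
  obtain ⟨-, hPt⟩ := hP
  obtain ⟨hQs, hQt⟩ := hQ
  exact ⟨hQs.mono (by omega), by simp only [time]; nlinarith⟩

theorem RunsWithin.ifLt (hσ : σ.SizeLE s) (hP : RunsWithin P σ s c) (hQ : RunsWithin Q σ s d) :
    RunsWithin (.ifLt q r P Q) σ s (1 + c + d) := by
  obtain ⟨hPs, hPt⟩ := hP
  obtain ⟨hQs, hQt⟩ := hQ
  have hq := hσ.1 q
  have hr := hσ.1 r
  simp only [RunsWithin, exec, time]
  split_ifs
  exacts [⟨hPs.mono (by omega), by nlinarith⟩, ⟨hQs.mono (by omega), by nlinarith⟩]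

theorem RunsWithin.loop (hσ : σ.SizeLE s) (hq : σ.reg q ≤ b)
    (hP : ∀ i, ((exec P)^[i] σ).SizeLE (s + i * c) →
      RunsWithin P ((exec P)^[i] σ) (s + i * c) c) :
    RunsWithin (.loop q P) σ s (1 + b * (1 + c)) := by
  have hsize : ∀ i, ((exec P)^[i] σ).SizeLE (s + i * c) := by
    intro i
    induction i with
    | zero => simpa using hσ
    | succ i ih =>
      rw [Function.iterate_succ_apply']
      exact (hP i ih).1.mono (by rw [Nat.succ_mul, add_assoc])
  refine ⟨(hsize _).mono (by nlinarith), ?_⟩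
  set L := 1 + 2 * (s + (1 + b * (1 + c))) with hL
  have hcounter : 1 + (σ.reg q).size ≤ L := by
    have := hσ.1 q
    omega
  have hround : ∀ i ∈ Finset.range (σ.reg q),
      1 + (σ.reg q).size + P.time ((exec P)^[i] σ) ≤ (1 + c) * L := by
    intro i hi
    have hi' : (i + 1) * c ≤ b * c :=
      Nat.mul_le_mul_right c ((Finset.mem_range.1 hi).trans_le hq)
    calc 1 + (σ.reg q).size + P.time ((exec P)^[i] σ)
        ≤ L + c * (1 + 2 * (s + i * c + c)) := add_le_add hcounter (hP i (hsize i)).2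
      _ ≤ L + c * L := by
        gcongr
        rw [hL]
        nlinarith
      _ = (1 + c) * L := by ring
  calc RamProg.time (.loop q P) σ
      ≤ L + σ.reg q * ((1 + c) * L) := by
        simp only [time]
        exact add_le_add hcounter (by simpa using Finset.sum_le_card_nsmul _ _ _ hround)
    _ ≤ L + b * ((1 + c) * L) := by gcongr
    _ = (1 + b * (1 + c)) * L := by ring

theorem RunsWithin.of_setReg {v : ℕ} (hσ : σ.SizeLE s) (hreg : (P.exec σ).reg = (σ.setReg r v).reg)
    (harr : (P.exec σ).arr = σ.arr) (hv : v.size ≤ s + c) (htime : P.time σ ≤ c + 2 * s)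
    (hc : 1 ≤ c) : RunsWithin P σ s c := by
  refine .of_time_le ?_ htime hc
  rw [RamState.SizeLE, hreg, harr]
  exact hσ.setReg r (Nat.le_add_right s c) hv

theorem RunsWithin.of_setReg_binary {v t : ℕ} (hσ : σ.SizeLE s)
    (hreg : (P.exec σ).reg = (σ.setReg r v).reg) (harr : (P.exec σ).arr = σ.arr)
    (hv : v.size ≤ s + c) (htime : P.time σ = 1 + (σ.reg q).size + (σ.reg t).size) (hc : 1 ≤ c) :
    RunsWithin P σ s c := by
  have hq := hσ.1 q
  have ht := hσ.1 t
  exact .of_setReg hσ hreg harr hv (by omega) hc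

theorem runsWithin_of_guardedBy {R : Finset ℕ} (hP : P.GuardedBy R) (hw : Disjoint R P.writes)
    (hσ : σ.SizeLE s) (hb : ∀ r ∈ R, σ.reg r ≤ b) : RunsWithin P σ s (P.cost.eval b) := by
  induction P generalizing σ s with simp only [cost, Polynomial.eval_add, Polynomial.eval_one,
    Polynomial.eval_mul, Polynomial.eval_X, Polynomial.eval_C]
  | skip => exact .of_time_le (hσ.mono (by omega)) (by simp [time]) le_rfl
  | const r c => exact .of_setReg hσ rfl rfl (by omega) (by simp [time]) (by omega)
  | copy r q =>
    have hq := hσ.1 q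
    exact .of_setReg hσ rfl rfl (by omega) (by simp only [time]; omega) le_rfl
  | add => exact .of_setReg_binary hσ rfl rfl (size_add_le (hσ.1 _) (hσ.1 _)) rfl le_rfl
  | sub => exact .of_setReg_binary hσ rfl rfl ((Nat.size_le_size (Nat.sub_le _ _)).trans
      (Nat.le_add_right_of_le (hσ.1 _))) rfl le_rfl
  | mul r q t => exact .of_setReg_binary hσ rfl rfl ((size_mul_le (hσ.1 q)
      ((size_le_self _).trans (hb t hP))).trans (by omega)) rfl (by omega)
  | div => exact .of_setReg_binary hσ rfl rfl ((Nat.size_le_size (Nat.div_le_self _ _)).trans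
      (Nat.le_add_right_of_le (hσ.1 _))) rfl le_rfl
  | load r a i =>
    have hi := hσ.1 i
    have ha := hσ.2 a (σ.reg i)
    exact .of_setReg hσ rfl rfl (by omega) (by simp only [time]; omega) le_rfl
  | store a i r =>
    have hi := hσ.1 i
    have hr := hσ.1 r
    exact .of_time_le (hσ.setArr a _ (by omega) (by omega)) (by simp only [time]; omega) le_rfl
  | readX r =>
    have hbit := (size_le_self _).trans (σ.tapeX 0).is_le
    exact .of_setReg hσ rfl rfl (by omega) (by simp [time]) le_rfl
  | readY r =>
    have hbit := (size_le_self _).trans (σ.tapeY 0).is_le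
    exact .of_setReg hσ rfl rfl (by omega) (by simp [time]) le_rfl
  | seq P Q ihP ihQ =>
    rw [writes, Finset.disjoint_union_right] at hw
    have h := ihP hP.1 hw.1 hσ hb
    exact h.seq (ihQ hP.2 hw.2 h.1 fun r hr =>
      (exec_reg_of_notMem_writes (Finset.disjoint_left.1 hw.1 hr) σ).trans_le (hb r hr))
  | ifLt q t P Q ihP ihQ =>
    rw [writes, Finset.disjoint_union_right] at hw
    exact .ifLt hσ (ihP hP.1 hw.1 hσ hb) (ihQ hP.2 hw.2 hσ hb)
  | loop q P ih =>
    rw [writes] at hw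
    refine .loop hσ (hb q hP.1) fun i hi => ih hP.2 hw hi fun r hr => ?_
    exact (iterate_exec_reg_of_notMem_writes (Finset.disjoint_left.1 hw hr) i σ).trans_le (hb r hr)

end RunsWithin

end RamProg

namespace OnlineAlg

theorem stateAfter_append_singleton (A : OnlineAlg) (n : ℕ) (l : List (ℝ × ℝ)) (z : ℝ × ℝ) :
    A.stateAfter n (l ++ [z]) = A.step.exec (feed z (A.stateAfter n l)) := by
  simp [stateAfter]

variable {A : OnlineAlg}

theorem stateAfter_reg_of_notMem_writes {r : ℕ} (h : r ∉ A.step.writes) (n : ℕ)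
    (l : List (ℝ × ℝ)) : (A.stateAfter n l).reg r = (A.init.exec (start n)).reg r := by
  induction l using List.reverseRecOn with
  | nil => rfl
  | append_singleton l z ih =>
    rw [stateAfter_append_singleton, RamProg.exec_reg_of_notMem_writes h]
    exact ih

theorem sizeLE_start (n : ℕ) : (start n).SizeLE n := by
  refine ⟨fun r => ?_, fun _ _ => by simp [start]⟩
  simp only [start]
  split_ifs
  exacts [size_le_self n, by simp]

theorem runsWithin_step {R : Finset ℕ} {n s b : ℕ} (hG : A.step.GuardedBy R)
    (hw : Disjoint R A.step.writes) (hs : (A.init.exec (start n)).SizeLE s)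
    (hb : ∀ r ∈ R, (A.init.exec (start n)).reg r ≤ b) (l : List (ℝ × ℝ)) (z : ℝ × ℝ) :
    RamProg.RunsWithin A.step (feed z (A.stateAfter n l)) (s + l.length * A.step.cost.eval b)
      (A.step.cost.eval b) := by
  have hreg : ∀ l, ∀ r ∈ R, (A.stateAfter n l).reg r ≤ b := fun l r hr =>
    (stateAfter_reg_of_notMem_writes (Finset.disjoint_left.1 hw hr) n l).trans_le (hb r hr)
  have hsize : (A.stateAfter n l).SizeLE (s + l.length * A.step.cost.eval b) := by
    induction l using List.reverseRecOn with
    | nil => simpa [stateAfter] using hs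
    | append_singleton l z ih =>
      rw [stateAfter_append_singleton]
      refine (RamProg.runsWithin_of_guardedBy (σ := feed z _) hG hw ih (hreg l)).1.mono ?_
      rw [List.length_append, List.length_singleton, add_one_mul, add_assoc]
  exact RamProg.runsWithin_of_guardedBy hG hw hsize (hreg l)

theorem isPolyTime_of_guardedBy {R : Finset ℕ} {I B : Polynomial ℕ}
    (hinit : ∀ n, RamProg.RunsWithin A.init (start n) n (I.eval n))
    (hB : ∀ n, ∀ r ∈ R, (A.init.exec (start n)).reg r ≤ B.eval n)
    (hG : A.step.GuardedBy R) (hw : Disjoint R A.step.writes) : A.IsPolyTime := by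
  let c : Polynomial ℕ := A.step.cost.comp B
  let X : Polynomial ℕ := Polynomial.X
  refine ⟨I * (1 + 2 * (X + I)) + X * (c * (1 + 2 * (X + I + X * c))), fun n p => ?_⟩
  have hstep : ∀ t : Fin n, A.step.time (feed (p t) (A.stateAfter n ((List.ofFn p).take t))) ≤
      c.eval n * (1 + 2 * (n + I.eval n + n * c.eval n)) := by
    intro t
    have h := (runsWithin_step hG hw (hinit n).1 (hB n) ((List.ofFn p).take t) (p t)).2
    rw [List.length_take, List.length_ofFn, min_eq_left t.2.le, add_assoc (n + _),
      ← add_one_mul] at h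
    simp only [c, Polynomial.eval_comp]
    refine h.trans ?_
    gcongr
    exact t.2
  have hsum := Finset.sum_le_card_nsmul Finset.univ _ _ fun t _ => hstep t
  rw [Finset.card_fin, smul_eq_mul] at hsum
  simpa [runTime, X] using add_le_add (hinit n).2 hsum

end OnlineAlg

/-- A family of integer vectors `h z`, indexed by the equally likely outcomes `z`, whose coordinates
are pairwise orthogonal as functions of `z`; each vector has entries of modulus at most one, at
most `N` of them nonzero. -/
structure IsSparseOrthogonal {Z V : Type*} [Fintype Z] [Fintype V] (h : Z → V → ℤ) (N : ℕ) :
    Prop where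
  abs_le_one : ∀ z v, |h z v| ≤ 1
  sum_abs_le : ∀ z, ∑ v, |h z v| ≤ N
  sum_mul_eq_zero : ∀ v v', v ≠ v' → ∑ z, h z v * h z v' = 0

theorem IsSparseOrthogonal.sum_sq_le {Z V : Type*} [Fintype Z] [Fintype V] {h : Z → V → ℤ}
    {N : ℕ} (hh : IsSparseOrthogonal h N) (z : Z) :
    ∑ v, (h z v : ℝ) ^ 2 ≤ N := by
  have hsq : ∑ v, h z v ^ 2 ≤ N := (Finset.sum_le_sum fun v _ => ?_).trans (hh.sum_abs_le z)
  · exact_mod_cast hsq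
  rw [← sq_abs]
  exact pow_le_of_le_one (abs_nonneg (h z v)) (hh.abs_le_one z v) two_ne_zero

theorem IsSparseOrthogonal.sum_sum_sq_mul_abs_le {Z V : Type*} [Fintype Z] [Fintype V]
    {h : Z → V → ℤ} {N : ℕ} (hh : IsSparseOrthogonal h N) (f : V → ℝ) :
    ∑ z, ∑ v, (h z v : ℝ) ^ 2 * |f v| ≤ N * ∑ z, |∑ v, h z v * f v| := by
  classical
  let σ : V → ℝ := fun v => SignType.sign (f v)
  have hσ : ∀ v, |σ v| ≤ 1 := fun v => by
    simp only [σ]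
    cases SignType.sign (f v) <;> simp
  have hcoord : ∀ v, ∑ z, (h z v : ℝ) ^ 2 * |f v| =
      ∑ v', ∑ z, (h z v' * σ v') * (h z v * f v) := by
    intro v
    rw [Finset.sum_eq_single_of_mem v (Finset.mem_univ v)]
    · refine Finset.sum_congr rfl fun z _ => ?_
      rw [← self_mul_sign (f v)]
      ring
    · intro v' _ hv'
      calc ∑ z, (h z v' * σ v') * (h z v * f v)
          = σ v' * f v * ((∑ z, h z v' * h z v : ℤ) : ℝ) := by
            push_cast
            rw [Finset.mul_sum]
            exact Finset.sum_congr rfl fun z _ => by ring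
        _ = 0 := by rw [hh.sum_mul_eq_zero v' v hv', Int.cast_zero, mul_zero]
  have hdual : ∑ z, ∑ v, (h z v : ℝ) ^ 2 * |f v| =
      ∑ z, (∑ v, h z v * σ v) * ∑ v, h z v * f v := by
    rw [Finset.sum_comm]
    simp only [hcoord, Finset.sum_mul_sum]
    rw [Finset.sum_comm, Finset.sum_congr rfl fun v' _ => Finset.sum_comm, Finset.sum_comm]
  rw [hdual, Finset.mul_sum]
  refine Finset.sum_le_sum fun z _ => ?_
  refine (le_abs_self _).trans ?_
  rw [abs_mul]
  gcongr
  calc |∑ v, h z v * σ v| ≤ ∑ v, |(h z v : ℝ) * σ v| := Finset.abs_sum_le_sum_abs _ _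
    _ ≤ ∑ v, |(h z v : ℝ)| := Finset.sum_le_sum fun v _ => by
      rw [abs_mul]
      exact mul_le_of_le_one_right (abs_nonneg _) (hσ v)
    _ ≤ N := by exact_mod_cast hh.sum_abs_le z

namespace Greedy

/-- The odd companion `r ^ x - r ^ (-x)` of the even function `r ^ x + r ^ (-x)` summed in the
potential. -/
noncomputable def slope (r : ℝ) (x : ℤ) : ℝ := r ^ x - r ^ (-x)

theorem zpow_add_zpow_neg_add {r : ℝ} (hr : 0 < r) (x : ℤ) {q : ℤ} (hq : |q| ≤ 1) :
    r ^ (x + q) + r ^ (-(x + q)) = r ^ x + r ^ (-x) +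
      (r - 1) ^ 2 / (2 * r) * (q ^ 2 * (r ^ x + r ^ (-x))) +
      (r ^ 2 - 1) / (2 * r) * (q * slope r x) := by
  obtain rfl | rfl | rfl : q = -1 ∨ q = 0 ∨ q = 1 := by
    rw [abs_le] at hq
    omega
  · simp only [slope, neg_add, neg_neg, zpow_add₀ hr.ne', zpow_neg_one, zpow_one]
    push_cast
    field_simp
    ring
  · simp
  · simp only [slope, neg_add, zpow_add₀ hr.ne', zpow_neg_one, zpow_one]
    push_cast
    field_simp
    ring

theorem zpow_add_zpow_neg_le {r : ℝ} (hr : 1 ≤ r) (x : ℤ) :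
    r ^ x + r ^ (-x) ≤ 2 + |slope r x| := by
  unfold slope
  rcases le_total 0 x with hx | hx
  · have hneg : r ^ (-x) ≤ 1 := zpow_le_one_of_nonpos₀ hr (by omega)
    linarith [le_abs_self (r ^ x - r ^ (-x))]
  · have hpos : r ^ x ≤ 1 := zpow_le_one_of_nonpos₀ hr hx
    linarith [neg_le_abs (r ^ x - r ^ (-x))]

theorem zpow_natCast_le_zpow_add_zpow_neg {r : ℝ} (hr : 1 ≤ r) {T : ℕ} {x : ℤ}
    (hT : (T : ℤ) ≤ |x|) : r ^ T ≤ r ^ x + r ^ (-x) := by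
  have : 0 < r := by positivity
  rw [← zpow_natCast]
  rcases le_abs.1 hT with hx | hx
  · exact (zpow_le_zpow_right₀ hr hx).trans (le_add_of_nonneg_right (by positivity))
  · exact (zpow_le_zpow_right₀ hr hx).trans (le_add_of_nonneg_left (by positivity))

section

variable {Z V : Type*} [Fintype V] (h : Z → V → ℤ) (r : ℝ)

/-- The first-order change of the potential at `d` in the direction `h z`, up to a positive
factor. -/
noncomputable def drift (d : V → ℤ) (z : Z) : ℝ := ∑ v, h z v * slope r (d v)

open scoped Classical in
/-- The sign chosen by the greedy algorithm for the vector `h z`. -/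
noncomputable def sign (d : V → ℤ) (z : Z) : ℤ := if drift h r d z < 0 then 1 else -1

/-- The signed sum of all vectors after `h z` has been given its sign. -/
noncomputable def next (d : V → ℤ) (z : Z) : V → ℤ := fun v => d v + sign h r d z * h z v

/-- The signed sum of all vectors after the arrivals listed in `l`. -/
noncomputable def run (d : V → ℤ) (l : List Z) : V → ℤ := l.foldl (next h r) d

/-- The exponential potential that the greedy algorithm tries to keep small. -/
noncomputable def potential (d : V → ℤ) : ℝ := ∑ v, (r ^ d v + r ^ (-d v))

variable {h r}

theorem abs_sign (d : V → ℤ) (z : Z) : |sign h r d z| = 1 := by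
  unfold sign
  split_ifs <;> rfl

theorem sign_mul_drift (d : V → ℤ) (z : Z) :
    (sign h r d z : ℝ) * drift h r d z = -|drift h r d z| := by
  unfold sign
  split_ifs with hneg
  · simp [abs_of_neg hneg]
  · simp [abs_of_nonneg (not_lt.1 hneg)]

theorem potential_next (hr : 0 < r) (d : V → ℤ) {z : Z} (hz : ∀ v, |h z v| ≤ 1) :
    potential r (next h r d z) = potential r d +
      (r - 1) ^ 2 / (2 * r) * ∑ v, (h z v : ℝ) ^ 2 * (r ^ d v + r ^ (-d v)) -
      (r ^ 2 - 1) / (2 * r) * |drift h r d z| := by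
  have hsq : ∀ v, ((sign h r d z * h z v : ℤ) : ℝ) ^ 2 = (h z v : ℝ) ^ 2 := fun v => by
    rw [← sq_abs, ← Int.cast_abs, abs_mul, abs_sign, one_mul, Int.cast_abs, sq_abs]
  have hcoord : ∀ v, |sign h r d z * h z v| ≤ 1 := fun v => by
    rw [abs_mul, abs_sign, one_mul]
    exact hz v
  have hlinear : ∑ v, ((sign h r d z * h z v : ℤ) : ℝ) * slope r (d v) = -|drift h r d z| := by
    rw [← sign_mul_drift, drift, Finset.mul_sum]
    push_cast
    simp only [mul_assoc]
  simp only [potential, next, zpow_add_zpow_neg_add hr _ (hcoord _), hsq]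
  rw [Finset.sum_add_distrib, Finset.sum_add_distrib, ← Finset.mul_sum, ← Finset.mul_sum, hlinear,
    mul_neg, ← sub_eq_add_neg]

theorem abs_run_le_length (hh : ∀ z v, |h z v| ≤ 1) (l : List Z) (v : V) :
    |run h r 0 l v| ≤ l.length := by
  induction l using List.reverseRecOn with
  | nil => simp [run]
  | append_singleton l z ih =>
    rw [run, List.foldl_append, List.length_append]
    refine (abs_add_le _ _).trans ?_
    rw [abs_mul, abs_sign, one_mul]
    exact_mod_cast add_le_add ih (hh z v)

variable [Fintype Z] {N : ℕ}

theorem sum_sum_sq_mul_zpow_le (hh : IsSparseOrthogonal h N) (hr : 1 ≤ r)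
    (d : V → ℤ) :
    ∑ z, ∑ v, (h z v : ℝ) ^ 2 * (r ^ d v + r ^ (-d v)) ≤
      N * (2 * Fintype.card Z + ∑ z, |drift h r d z|) := by
  calc ∑ z, ∑ v, (h z v : ℝ) ^ 2 * (r ^ d v + r ^ (-d v))
      ≤ ∑ z, ∑ v, (h z v : ℝ) ^ 2 * (2 + |slope r (d v)|) := by
        gcongr ∑ z, ∑ v, _ * ?_ with z _ v
        exact zpow_add_zpow_neg_le hr _
    _ = 2 * ∑ z, ∑ v, (h z v : ℝ) ^ 2 + ∑ z, ∑ v, (h z v : ℝ) ^ 2 * |slope r (d v)| := by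
        simp only [mul_add, Finset.sum_add_distrib, ← Finset.sum_mul]
        ring
    _ ≤ 2 * ∑ _z : Z, (N : ℝ) + N * ∑ z, |drift h r d z| := by
        gcongr
        exacts [hh.sum_sq_le _, hh.sum_sum_sq_mul_abs_le _]
    _ = N * (2 * Fintype.card Z + ∑ z, |drift h r d z|) := by
        simp only [Finset.sum_const, Finset.card_univ, nsmul_eq_mul]
        ring

theorem sum_potential_next_le (hh : IsSparseOrthogonal h N) (hr : 1 < r)
    (hN : N * (r - 1) ≤ r + 1) (d : V → ℤ) :
    ∑ z, potential r (next h r d z) ≤ Fintype.card Z * (potential r d + (r - r⁻¹)) := by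
  have hr0 : 0 < r := by positivity
  set γ := (r - 1) ^ 2 / (2 * r) with hγ
  set δ := (r ^ 2 - 1) / (2 * r) with hδ
  have hγδ : γ * N ≤ δ := by
    rw [hγ, hδ, div_mul_eq_mul_div]
    gcongr
    nlinarith
  have hδr : 2 * δ = r - r⁻¹ := by
    rw [hδ]
    field_simp
  have hγ0 : 0 ≤ γ := by positivity
  have hgain : γ * ∑ z, ∑ v, (h z v : ℝ) ^ 2 * (r ^ d v + r ^ (-d v)) ≤
      δ * (2 * Fintype.card Z + ∑ z, |drift h r d z|) := by
    refine (mul_le_mul_of_nonneg_left (sum_sum_sq_mul_zpow_le hh hr.le d) hγ0).trans ?_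
    rw [← mul_assoc]
    gcongr
  simp only [potential_next hr0 d (hh.abs_le_one _), Finset.sum_sub_distrib,
    Finset.sum_add_distrib, ← Finset.mul_sum, Finset.sum_const, Finset.card_univ, nsmul_eq_mul,
    ← hδr]
  linarith

theorem sum_potential_run_le (hh : IsSparseOrthogonal h N) (hr : 1 < r)
    (hN : N * (r - 1) ≤ r + 1) (n : ℕ) (d : V → ℤ) :
    ∑ c : Fin n → Z, potential r (run h r d (List.ofFn c)) ≤
      Fintype.card Z ^ n * (potential r d + n * (r - r⁻¹)) := by
  induction n generalizing d with
  | zero => simp [run]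
  | succ n ih =>
    have hcons : ∀ (z : Z) (c : Fin n → Z),
        run h r d (List.ofFn (Fin.consEquiv (fun _ => Z) (z, c))) =
          run h r (next h r d z) (List.ofFn c) := fun z c => by
      simp [run, List.ofFn_succ, Fin.consEquiv]
    rw [← (Fin.consEquiv fun _ : Fin (n + 1) => Z).sum_comp, Fintype.sum_prod_type]
    simp only [hcons]
    calc ∑ z, ∑ c : Fin n → Z, potential r (run h r (next h r d z) (List.ofFn c))
        ≤ ∑ z, Fintype.card Z ^ n * (potential r (next h r d z) + n * (r - r⁻¹)) :=
          Finset.sum_le_sum fun z _ => ih _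
      _ = Fintype.card Z ^ n *
            (∑ z, potential r (next h r d z) + Fintype.card Z * (n * (r - r⁻¹))) := by
          rw [← Finset.mul_sum, Finset.sum_add_distrib]
          simp
      _ ≤ Fintype.card Z ^ n * (Fintype.card Z * (potential r d + (r - r⁻¹)) +
            Fintype.card Z * (n * (r - r⁻¹))) := by
          gcongr
          exact sum_potential_next_le hh hr hN d
      _ = Fintype.card Z ^ (n + 1) * (potential r d + (n + 1 : ℕ) * (r - r⁻¹)) := by
          push_cast
          ring

theorem card_exists_lt_abs_run_mul_pow_le (hh : IsSparseOrthogonal h N) (hr : 1 < r)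
    (hN : N * (r - 1) ≤ r + 1) (n T : ℕ) :
    (({c | ∃ v, (T : ℤ) < |run h r 0 (List.ofFn c) v|} : Finset (Fin n → Z)).card : ℝ) * r ^ T ≤
      Fintype.card Z ^ n * (2 * Fintype.card V + n * (r - r⁻¹)) := by
  have : 0 < r := by positivity
  have hzero : potential r (0 : V → ℤ) = 2 * Fintype.card V := by
    simp only [potential, Pi.zero_apply, neg_zero, zpow_zero, Finset.sum_const, Finset.card_univ,
      nsmul_eq_mul]
    ring
  rw [← hzero, ← nsmul_eq_mul]
  refine le_trans ?_ (sum_potential_run_le hh hr hN n 0)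
  refine (Finset.card_nsmul_le_sum _ _ _ fun c hc => ?_).trans
    (Finset.sum_le_univ_sum_of_nonneg fun c => Finset.sum_nonneg fun v _ => by positivity)
  obtain ⟨v, hv⟩ := (Finset.mem_filter.1 hc).2
  exact (zpow_natCast_le_zpow_add_zpow_neg hr.le hv.le).trans
    (Finset.single_le_sum (f := fun v => r ^ _ + r ^ (-_)) (fun v _ => by positivity)
      (Finset.mem_univ v))

end

end Greedy

section Occupancy

variable {α β : Type*} [Fintype α]

theorem card_le_card_filter_mul_two_pow_le (n R : ℕ) (p : α → Prop) [DecidablePred p] :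
    ({c | R ≤ ({t | p (c t)} : Finset (Fin n)).card} : Finset (Fin n → α)).card * 2 ^ R ≤
      (Fintype.card α + ({a | p a} : Finset α).card) ^ n := by
  have hweight : ∑ a : α, (if p a then 2 else 1) =
      Fintype.card α + ({a | p a} : Finset α).card := by
    rw [Finset.card_filter, ← Finset.card_univ, Finset.card_eq_sum_ones, ← Finset.sum_add_distrib]
    exact Finset.sum_congr rfl fun a _ => by split_ifs <;> rfl
  have hproduct : ∑ c : Fin n → α, ∏ t, (if p (c t) then 2 else 1) =
      (Fintype.card α + ({a | p a} : Finset α).card) ^ n := by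
    rw [← Fintype.piFinset_univ, ← Finset.prod_univ_sum (fun _ => Finset.univ)
      (fun _ a => if p a then 2 else 1)]
    simp [hweight]
  rw [← hproduct, ← smul_eq_mul]
  refine (Finset.card_nsmul_le_sum _ _ _ fun c hc => ?_).trans
    (Finset.sum_le_univ_sum_of_nonneg fun c => Nat.zero_le _)
  rw [Finset.prod_ite, Finset.prod_const, Finset.prod_const_one, mul_one]
  exact Nat.pow_le_pow_right two_pos (Finset.mem_filter.1 hc).2

theorem add_one_pow_le_three_mul_pow {n q : ℕ} (h : n ≤ q) : (q + 1) ^ n ≤ 3 * q ^ n := by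
  rcases Nat.eq_zero_or_pos q with rfl | hq
  · simp [Nat.le_zero.1 h]
  have hexp : (1 + 1 / q : ℝ) ^ n ≤ 3 := by
    calc (1 + 1 / q : ℝ) ^ n ≤ Real.exp (1 / q) ^ n := by
          gcongr
          rw [add_comm]
          exact Real.add_one_le_exp _
      _ = Real.exp (n / q) := by rw [← Real.exp_nat_mul, mul_one_div]
      _ ≤ Real.exp 1 := by
          gcongr
          exact div_le_one_of_le₀ (by exact_mod_cast h) (by positivity)
      _ ≤ 3 := Real.exp_one_lt_three.le
  have hsplit : (q + 1 : ℝ) = (1 + 1 / q) * q := by field_simp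
  have : (q + 1 : ℝ) ^ n ≤ 3 * q ^ n := by
    rw [hsplit, mul_pow]
    gcongr
  exact_mod_cast this

theorem card_exists_le_card_fiber_mul_two_pow_le [Fintype β] [DecidableEq β] {n : ℕ}
    (R : ℕ) (f : α → β)
    (hf : ∀ b, ({a | f a = b} : Finset α).card * Fintype.card β = Fintype.card α)
    (hn : n ≤ Fintype.card β) :
    ({c | ∃ b, R ≤ ({t | f (c t) = b} : Finset (Fin n)).card} : Finset (Fin n → α)).card * 2 ^ R ≤
      3 * Fintype.card β * Fintype.card α ^ n := by
  classical
  let visits (b : β) : Finset (Fin n → α) := {c | R ≤ ({t | f (c t) = b} : Finset (Fin n)).card}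
  have hvisits : ∀ b, (visits b).card * 2 ^ R ≤ 3 * Fintype.card α ^ n := fun b => by
    set k := ({a | f a = b} : Finset α).card
    calc (visits b).card * 2 ^ R
        ≤ (Fintype.card α + k) ^ n := card_le_card_filter_mul_two_pow_le n R (f · = b)
      _ = k ^ n * (Fintype.card β + 1) ^ n := by rw [← hf b, ← mul_add_one, mul_pow]
      _ ≤ k ^ n * (3 * Fintype.card β ^ n) := by
          gcongr
          exact add_one_pow_le_three_mul_pow hn
      _ = 3 * Fintype.card α ^ n := by rw [← hf b, mul_pow, mul_left_comm]
  have hunion : ({c | ∃ b, R ≤ ({t | f (c t) = b} : Finset (Fin n)).card} : Finset (Fin n → α)) =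
      Finset.univ.biUnion visits := by
    ext c
    simp [visits]
  calc _ ≤ (∑ b, (visits b).card) * 2 ^ R := by
        rw [hunion]
        gcongr
        exact Finset.card_biUnion_le
    _ ≤ ∑ _b : β, 3 * Fintype.card α ^ n := by
        rw [Finset.sum_mul]
        exact Finset.sum_le_sum fun b _ => hvisits b
    _ = 3 * Fintype.card β * Fintype.card α ^ n := by
        rw [Finset.sum_const, Finset.card_univ, smul_eq_mul]
        ring

end Occupancy

namespace Haar

/-- The sign belonging to the binary digit number `i` of `w`. -/
def bitSign (w i : ℕ) : ℤ := if w.testBit i then -1 else 1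

/-- The value at `w` of the Haar function of the dyadic block `{u * 2 ^ (i + 1), …}` of length
`2 ^ (i + 1)`: it is `1` on the left half and `-1` on the right half of the block. -/
def haar (i u w : ℕ) : ℤ := if w / 2 ^ (i + 1) = u then bitSign w i else 0

theorem abs_bitSign (w i : ℕ) : |bitSign w i| = 1 := by
  unfold bitSign
  split_ifs <;> rfl

theorem bitSign_eq_ite_mod (w i : ℕ) :
    bitSign w i = if w / 2 ^ i % 2 = 0 then 1 else -1 := by
  rw [bitSign, Nat.testBit_eq_decide_div_mod_eq]
  rcases Nat.mod_two_eq_zero_or_one (w / 2 ^ i) with h | h <;> simp [h]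

theorem abs_haar (i u w : ℕ) : |haar i u w| = if w / 2 ^ (i + 1) = u then 1 else 0 := by
  unfold haar
  split_ifs
  exacts [abs_bitSign w i, abs_zero]

theorem abs_haar_le_one (i u w : ℕ) : |haar i u w| ≤ 1 := by
  rw [abs_haar]
  split_ifs <;> simp

theorem div_two_pow_lt {m w : ℕ} (hw : w < 2 ^ m) (i : ℕ) : w / 2 ^ i < 2 ^ m :=
  (Nat.div_le_self _ _).trans_lt hw

theorem haar_top {m w : ℕ} (hw : w < 2 ^ m) : haar m 0 w = 1 := by
  rw [haar, if_pos (Nat.div_eq_of_lt (hw.trans (Nat.pow_lt_pow_succ one_lt_two))), bitSign,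
    Nat.testBit_lt_two_pow hw]
  rfl

theorem xor_two_pow_div_two_pow {w i j : ℕ} (h : i < j) : (w ^^^ 2 ^ i) / 2 ^ j = w / 2 ^ j := by
  rw [← Nat.shiftRight_eq_div_pow, ← Nat.shiftRight_eq_div_pow]
  refine Nat.eq_of_testBit_eq fun k => ?_
  have hne : i ≠ j + k := by omega
  simp [Nat.testBit_shiftRight, Nat.testBit_xor, hne]

theorem haar_xor_two_pow_self (i u w : ℕ) : haar i u (w ^^^ 2 ^ i) = -haar i u w := by
  rw [haar, haar, xor_two_pow_div_two_pow (Nat.lt_succ_self i), bitSign, bitSign, Nat.testBit_xor,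
    Nat.testBit_two_pow]
  cases w.testBit i <;> simp [apply_ite]

theorem haar_xor_two_pow_of_lt {i j : ℕ} (h : i < j) (u w : ℕ) :
    haar j u (w ^^^ 2 ^ i) = haar j u w := by
  rw [haar, haar, xor_two_pow_div_two_pow (Nat.lt_succ_of_lt h), bitSign, bitSign,
    Nat.testBit_xor, Nat.testBit_two_pow]
  simp [h.ne]

theorem sum_eq_zero_of_xor_two_pow {m i : ℕ} (hi : i < m) {f : ℕ → ℤ}
    (hf : ∀ w, f (w ^^^ 2 ^ i) = -f w) : ∑ w : Fin (2 ^ m), f w = 0 := by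
  have hmaps : ∀ w ∈ Finset.range (2 ^ m), w ^^^ 2 ^ i ∈ Finset.range (2 ^ m) := fun w hw =>
    Finset.mem_range.2 (Nat.xor_lt_two_pow (Finset.mem_range.1 hw)
      (Nat.pow_lt_pow_right one_lt_two hi))
  have hneg : ∑ w ∈ Finset.range (2 ^ m), f w = -∑ w ∈ Finset.range (2 ^ m), f w := by
    rw [← Finset.sum_neg_distrib]
    exact Finset.sum_nbij' (· ^^^ 2 ^ i) (· ^^^ 2 ^ i) hmaps hmaps (by simp) (by simp)
      fun w _ => by rw [hf, neg_neg]
  rw [Fin.sum_univ_eq_sum_range]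
  omega

theorem sum_haar_eq_zero {m i : ℕ} (hi : i < m) (u : ℕ) : ∑ w : Fin (2 ^ m), haar i u w = 0 :=
  sum_eq_zero_of_xor_two_pow hi (haar_xor_two_pow_self i u)

theorem sum_haar_mul_haar_eq_zero {m i j u v : ℕ} (hi : i ≤ m) (hj : j ≤ m)
    (hne : (i, u) ≠ (j, v)) : ∑ w : Fin (2 ^ m), haar i u w * haar j v w = 0 := by
  rcases lt_trichotomy i j with hij | rfl | hij
  · refine sum_eq_zero_of_xor_two_pow (f := fun w => haar i u w * haar j v w)
      (hij.trans_le hj) fun w => ?_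
    rw [haar_xor_two_pow_self, haar_xor_two_pow_of_lt hij, neg_mul]
  · refine Finset.sum_eq_zero fun w _ => ?_
    have huv : u ≠ v := fun h => hne (by rw [h])
    unfold haar
    split_ifs with h1 h2
    · exact absurd (h1.symm.trans h2) huv
    all_goals simp
  · refine sum_eq_zero_of_xor_two_pow (f := fun w => haar i u w * haar j v w)
      (hij.trans_le hi) fun w => ?_
    rw [haar_xor_two_pow_self, haar_xor_two_pow_of_lt hij, mul_neg]

theorem sum_ite_block {M : Type*} [AddCommMonoid M] {m : ℕ} (i : ℕ) (w : Fin (2 ^ m))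
    (f : ℕ → M) :
    ∑ u : Fin (2 ^ m), (if (w : ℕ) / 2 ^ (i + 1) = u then f u else 0) = f (w / 2 ^ (i + 1)) := by
  rw [Fin.sum_univ_eq_sum_range (fun u => if (w : ℕ) / 2 ^ (i + 1) = u then f u else 0),
    Finset.sum_ite_eq, if_pos (Finset.mem_range.2 (div_two_pow_lt w.2 _))]

/-- The dyadic blocks of both coordinate axes, each given by its level and its number. The whole
axis, at level `m`, occurs for the first axis only, since both copies would carry the same
(constant) function. -/
abbrev Block (m : ℕ) := Fin (m + 1) × Fin (2 ^ m) ⊕ Fin m × Fin (2 ^ m)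

/-- The Haar functions of all dyadic blocks, evaluated at a cell of the `2 ^ m × 2 ^ m` grid. -/
def gridHaar (m : ℕ) (z : Fin (2 ^ m) × Fin (2 ^ m)) : Block m → ℤ
  | .inl (i, u) => haar i u z.1
  | .inr (i, u) => haar i u z.2

theorem card_block (m : ℕ) : Fintype.card (Block m) = (2 * m + 1) * 2 ^ m := by
  simp only [Fintype.card_sum, Fintype.card_prod, Fintype.card_fin]
  ring

theorem sum_abs_gridHaar (m : ℕ) (z : Fin (2 ^ m) × Fin (2 ^ m)) :
    ∑ v, |gridHaar m z v| = (2 * m + 1 : ℕ) := by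
  have hlevel (i : ℕ) (w : Fin (2 ^ m)) : ∑ u : Fin (2 ^ m), |haar i u w| = 1 := by
    simp only [abs_haar]
    exact sum_ite_block i w fun _ => 1
  simp only [Fintype.sum_sum_type, Fintype.sum_prod_type, gridHaar, hlevel, Finset.sum_const,
    Finset.card_univ, Fintype.card_fin, nsmul_eq_mul]
  push_cast
  ring

theorem isSparseOrthogonal_gridHaar (m : ℕ) : IsSparseOrthogonal (gridHaar m) (2 * m + 1) where
  abs_le_one := by
    rintro z (⟨i, u⟩ | ⟨i, u⟩) <;> exact abs_haar_le_one _ _ _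
  sum_abs_le z := (sum_abs_gridHaar m z).le
  sum_mul_eq_zero := by
    rintro (⟨i, u⟩ | ⟨i, u⟩) (⟨j, v⟩ | ⟨j, v⟩) hne <;>
      simp only [gridHaar, Fintype.sum_prod_type]
    · rw [Finset.sum_comm]
      refine Finset.sum_eq_zero fun _ _ => sum_haar_mul_haar_eq_zero i.is_le j.is_le ?_
      simpa [Prod.ext_iff, Fin.ext_iff] using hne
    · simp only [← Finset.mul_sum, sum_haar_eq_zero j.2, mul_zero, Finset.sum_const_zero]
    · simp only [← Finset.sum_mul, sum_haar_eq_zero i.2, zero_mul, Finset.sum_const_zero]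
    · refine Finset.sum_eq_zero fun _ _ => sum_haar_mul_haar_eq_zero i.2.le j.2.le ?_
      simpa [Prod.ext_iff, Fin.ext_iff] using hne

section Prefix

variable {ι : Type*} [Fintype ι] {m : ℕ} {χ : ι → ℤ} {w : ι → Fin (2 ^ m)} {T : ℤ}

theorem abs_sum_mul_haar_le (htotal : |∑ t, χ t| ≤ T)
    (hcoeff : ∀ (i : Fin m) (u : Fin (2 ^ m)), |∑ t, χ t * haar i u (w t)| ≤ T)
    {i : ℕ} (hi : i < m) (u : ℕ) : |∑ t, χ t * haar i u (w t)| ≤ T := by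
  by_cases hu : u < 2 ^ m
  · exact hcoeff ⟨i, hi⟩ ⟨u, hu⟩
  · have hzero : ∀ t, haar i u (w t) = 0 := fun t =>
      if_neg fun h : (w t : ℕ) / 2 ^ (i + 1) = u => hu (h ▸ div_two_pow_lt (w t).2 _)
    simpa only [hzero, mul_zero, Finset.sum_const_zero, abs_zero] using (abs_nonneg _).trans htotal

theorem abs_sum_block_le (htotal : |∑ t, χ t| ≤ T)
    (hcoeff : ∀ (i : Fin m) (u : Fin (2 ^ m)), |∑ t, χ t * haar i u (w t)| ≤ T)
    {j k : ℕ} (hj : j + k = m) (u : ℕ) :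
    |∑ t, if (w t : ℕ) / 2 ^ j = u then χ t else 0| ≤ T := by
  induction k generalizing j u with
  | zero =>
    obtain rfl : j = m := hj
    simp only [Nat.div_eq_of_lt (w _).2]
    split_ifs
    · exact htotal
    · simpa using (abs_nonneg _).trans htotal
  | succ k ih =>
    have hparent := ih (j := j + 1) (by omega) (u / 2)
    have hhaar := abs_sum_mul_haar_le htotal hcoeff (i := j) (by omega) (u / 2)
    have hhalf : 2 * (∑ t, if (w t : ℕ) / 2 ^ j = u then χ t else 0) =
        (∑ t, if (w t : ℕ) / 2 ^ (j + 1) = u / 2 then χ t else 0) +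
          (if u % 2 = 0 then 1 else -1) * ∑ t, χ t * haar j (u / 2) (w t) := by
      rw [Finset.mul_sum, Finset.mul_sum, ← Finset.sum_add_distrib]
      refine Finset.sum_congr rfl fun t _ => ?_
      rw [haar, bitSign_eq_ite_mod, pow_succ, ← Nat.div_div_eq_div_mul]
      generalize (w t : ℕ) / 2 ^ j = a
      split_ifs <;> omega
    rw [abs_le] at hparent hhaar ⊢
    split_ifs at hhalf <;> constructor <;> linarith

theorem abs_sum_lt_le (htotal : |∑ t, χ t| ≤ T)
    (hcoeff : ∀ (i : Fin m) (u : Fin (2 ^ m)), |∑ t, χ t * haar i u (w t)| ≤ T)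
    {j k : ℕ} (hj : j + k = m) (u : ℕ) :
    |∑ t, if (w t : ℕ) / 2 ^ j < u then χ t else 0| ≤ (k + 1) * T := by
  have hT : 0 ≤ T := (abs_nonneg _).trans htotal
  induction k generalizing j u with
  | zero =>
    obtain rfl : j = m := hj
    simp only [Nat.div_eq_of_lt (w _).2]
    split_ifs <;> simpa
  | succ k ih =>
    have hparent := ih (j := j + 1) (by omega) (u / 2)
    have hblock := abs_sum_block_le htotal hcoeff hj (u - 1)
    have hsplit : (∑ t, if (w t : ℕ) / 2 ^ j < u then χ t else 0) =
        (∑ t, if (w t : ℕ) / 2 ^ (j + 1) < u / 2 then χ t else 0) +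
          (if u % 2 = 1 then 1 else 0) * ∑ t, if (w t : ℕ) / 2 ^ j = u - 1 then χ t else 0 := by
      rw [Finset.mul_sum, ← Finset.sum_add_distrib]
      refine Finset.sum_congr rfl fun t _ => ?_
      rw [pow_succ, ← Nat.div_div_eq_div_mul]
      generalize (w t : ℕ) / 2 ^ j = a
      split_ifs <;> omega
    rw [hsplit]
    push_cast
    rw [abs_le] at hparent hblock ⊢
    split_ifs <;> constructor <;> linarith

end Prefix

open scoped Classical in
theorem abs_sum_Icc_sub_sum_lt_sub_sum_lt_le {ι α β : Type*} [Fintype ι] [LinearOrder α]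
    [LinearOrder β] {f : α → β} (hf : Monotone f) {χ : ι → ℤ} (hχ : ∀ t, |χ t| ≤ 1) (x : ι → α)
    {a b : α} (hab : a ≤ b) :
    |(∑ t, if x t ∈ Icc a b then χ t else 0) - ((∑ t, if f (x t) < f b then χ t else 0) -
      ∑ t, if f (x t) < f a then χ t else 0)| ≤
      ({t | f (x t) = f a} : Finset ι).card + ({t | f (x t) = f b} : Finset ι).card := by
  have hterm : ∀ t, |(if x t ∈ Icc a b then χ t else 0) - ((if f (x t) < f b then χ t else 0) -
      if f (x t) < f a then χ t else 0)| ≤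
      (if f (x t) = f a then 1 else 0) + if f (x t) = f b then 1 else 0 := by
    intro t
    have hab' := hf hab
    by_cases hend : f (x t) = f a ∨ f (x t) = f b
    · rcases hend with hend | hend <;> rw [hend] <;> have := hχ t <;> split_ifs <;> grind
    · have hmem : x t ∈ Icc a b ↔ f a < f (x t) ∧ f (x t) < f b := by
        refine ⟨fun h => ?_, fun h => ⟨(hf.reflect_lt h.1).le, (hf.reflect_lt h.2).le⟩⟩
        exact ⟨(hf h.1).lt_of_ne fun h' => hend (.inl h'.symm),
          (hf h.2).lt_of_ne fun h' => hend (.inr h')⟩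
      simp only [hmem]
      grind
  rw [← Finset.sum_sub_distrib, ← Finset.sum_sub_distrib]
  refine (Finset.abs_sum_le_sum_abs _ _).trans ((Finset.sum_le_sum fun t _ => hterm t).trans ?_)
  rw [Finset.sum_add_distrib, Finset.sum_boole, Finset.sum_boole]

end Haar

/-- The number of the dyadic interval of length `2 ^ (-m)` containing `x ∈ [0, 1)`. -/
noncomputable def dyadic (m : ℕ) (x : ℝ) : Fin (2 ^ m) := Fin.ofNat (2 ^ m) ⌊x * 2 ^ m⌋₊

/-- The cell of the `2 ^ m × 2 ^ m` grid containing the point `z` of `[0, 1) × [0, 1)`. -/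
noncomputable def cell (m : ℕ) (z : ℝ × ℝ) : Fin (2 ^ m) × Fin (2 ^ m) :=
  (dyadic m z.1, dyadic m z.2)

theorem floor_mul_two_pow_lt {x : ℝ} (hx : x ∈ Ico (0 : ℝ) 1) (m : ℕ) :
    ⌊x * 2 ^ m⌋₊ < 2 ^ m := by
  rw [Nat.floor_lt (mul_nonneg hx.1 (by positivity))]
  push_cast
  exact mul_lt_of_lt_one_left (by positivity) hx.2

theorem coe_dyadic {x : ℝ} (hx : x ∈ Ico (0 : ℝ) 1) (m : ℕ) :
    (dyadic m x : ℕ) = ⌊x * 2 ^ m⌋₊ :=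
  Nat.mod_eq_of_lt (floor_mul_two_pow_lt hx m)

open scoped Classical in
theorem abs_sum_Icc_le {ι : Type*} [Fintype ι] {m R : ℕ} {T : ℤ} {χ : ι → ℤ}
    (hχ : ∀ t, |χ t| ≤ 1) {x : ι → ℝ} (hx : ∀ t, x t ∈ Ico (0 : ℝ) 1)
    (htotal : |∑ t, χ t| ≤ T)
    (hcoeff : ∀ (i : Fin m) (u : Fin (2 ^ m)), |∑ t, χ t * Haar.haar i u (dyadic m (x t))| ≤ T)
    (hcount : ∀ u, ({t | dyadic m (x t) = u} : Finset ι).card ≤ R) {a b : ℝ} (hab : a ≤ b) :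
    |∑ t, if x t ∈ Icc a b then χ t else 0| ≤ 2 * (m + 1) * T + 2 * R := by
  let f : ℝ → ℕ := fun y => ⌊y * 2 ^ m⌋₊
  have hf : Monotone f := fun y z hyz => Nat.floor_le_floor (by gcongr)
  have hdyadic : ∀ t, (dyadic m (x t) : ℕ) = f (x t) := fun t => coe_dyadic (hx t) m
  have hprefix : ∀ u, |∑ t, if f (x t) < u then χ t else 0| ≤ (m + 1) * T := fun u => by
    simpa only [pow_zero, Nat.div_one, hdyadic] using
      Haar.abs_sum_lt_le htotal hcoeff (zero_add m) u
  have hleaf : ∀ u, (({t | f (x t) = u} : Finset ι).card : ℤ) ≤ R := fun u => by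
    rcases Finset.eq_empty_or_nonempty ({t | f (x t) = u} : Finset ι) with hempty | ⟨s, hs⟩
    · simp [hempty]
    · rw [← (Finset.mem_filter.1 hs).2]
      simpa only [← hdyadic, Fin.val_inj, Nat.cast_le] using hcount (dyadic m (x s))
  have hclose := abs_le.1 (Haar.abs_sum_Icc_sub_sum_lt_sub_sum_lt_le hf hχ x hab)
  have ha := abs_le.1 (hprefix (f a))
  have hb := abs_le.1 (hprefix (f b))
  have hRa := hleaf (f a)
  have hRb := hleaf (f b)
  rw [abs_le]
  constructor <;> linarith

open scoped Classical in
theorem imbalance_vertical {n : ℕ} {p : Fin n → ℝ × ℝ} (χ : Fin n → ℤ)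
    (hp : ∀ t, (p t).2 ∈ Ico (0 : ℝ) 1) (a b : ℝ) :
    imbalance p χ (Icc a b ×ˢ Icc 0 1) = ∑ t, if (p t).1 ∈ Icc a b then χ t else 0 :=
  Finset.sum_congr rfl fun t _ => by simp only [mem_prod, Ico_subset_Icc_self (hp t), and_true]

open scoped Classical in
theorem imbalance_horizontal {n : ℕ} {p : Fin n → ℝ × ℝ} (χ : Fin n → ℤ)
    (hp : ∀ t, (p t).1 ∈ Ico (0 : ℝ) 1) (a b : ℝ) :
    imbalance p χ (Icc 0 1 ×ˢ Icc a b) = ∑ t, if (p t).2 ∈ Icc a b then χ t else 0 :=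
  Finset.sum_congr rfl fun t _ => by simp only [mem_prod, Ico_subset_Icc_self (hp t), true_and]

open scoped Classical in
theorem stripeDisc_le {n m T R : ℕ} {p : Fin n → ℝ × ℝ} {χ : Fin n → ℤ} (hχ : ∀ t, |χ t| ≤ 1)
    (hp : ∀ t, p t ∈ Ico (0 : ℝ) 1 ×ˢ Ico (0 : ℝ) 1)
    (hcoeff : ∀ v, |∑ t, χ t * Haar.gridHaar m (cell m (p t)) v| ≤ (T : ℤ))
    (hX : ∀ u, ({t | (cell m (p t)).1 = u} : Finset (Fin n)).card ≤ R)
    (hY : ∀ u, ({t | (cell m (p t)).2 = u} : Finset (Fin n)).card ≤ R) :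
    stripeDisc p χ ≤ 2 * (m + 1) * T + 2 * R := by
  have htotal : |∑ t, χ t| ≤ (T : ℤ) := by
    simpa [Haar.gridHaar, Haar.haar_top] using hcoeff (.inl (Fin.last m, 0))
  have hvertical (a b : ℝ) (hab : a ≤ b) :=
    abs_sum_Icc_le hχ (fun t => (hp t).1) htotal (fun i u => hcoeff (.inl (i.castSucc, u))) hX hab
  have hhorizontal (a b : ℝ) (hab : a ≤ b) :=
    abs_sum_Icc_le hχ (fun t => (hp t).2) htotal (fun i u => hcoeff (.inr (i, u))) hY hab
  have : Nonempty stripes := ⟨⟨Icc 0 1 ×ˢ Icc 0 1, 0, 1, le_rfl, one_pos, le_rfl, .inl rfl⟩⟩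
  refine ciSup_le ?_
  rintro ⟨S, a, b, -, hab, -, rfl | rfl⟩
  · simp only
    rw [imbalance_vertical χ (fun t => (hp t).2)]
    exact_mod_cast hvertical a b hab.le
  · simp only
    rw [imbalance_horizontal χ (fun t => (hp t).1)]
    exact_mod_cast hhorizontal a b hab.le

namespace StripeAlg

open RamProg

-- Registers; the numbers of `count` and `color` are prescribed by `OnlineAlg.start` and
-- `OnlineAlg.color`.
abbrev count : ℕ := 0
abbrev color : ℕ := 1
abbrev one : ℕ := 2
abbrev two : ℕ := 3
abbrev depth : ℕ := 4
abbrev depthSucc : ℕ := 5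
abbrev width : ℕ := 6
abbrev countTwice : ℕ := 7
abbrev power : ℕ := 8
abbrev index : ℕ := 9
abbrev leafX : ℕ := 10
abbrev leafY : ℕ := 11
abbrev node : ℕ := 12
abbrev offset : ℕ := 13
abbrev parent : ℕ := 14
abbrev double : ℕ := 15
abbrev bit : ℕ := 16
abbrev addr : ℕ := 17
abbrev plus : ℕ := 18
abbrev minus : ℕ := 19
abbrev up : ℕ := 20
abbrev down : ℕ := 21
abbrev accUp : ℕ := 22
abbrev accDown : ℕ := 23
-- Arrays, numbered independently of the registers.
abbrev posX : ℕ := 0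
abbrev negX : ℕ := 1
abbrev posY : ℕ := 2
abbrev negY : ℕ := 3
abbrev table : ℕ := 4

/-- The sequential composition of a list of programs. -/
def block : List RamProg → RamProg
  | [] => skip
  | [P] => P
  | P :: l => seq P (block l)

/-- One round of the search for the depth, which keeps `width = 2 ^ depth`. -/
def grow : RamProg :=
  ifLt width count (seq (add width width width) (add depth depth one)) skip

/-- Finds the depth `m` of the grid, the least number with `n ≤ 2 ^ m`. -/
def initDepth : RamProg :=
  block [const one 1, const two 2, const depth 0, const width 1, loop count grow,
    add depthSucc depth one, add countTwice count count]

/-- Stores the current power in the table and multiplies it by `(m + 1) / m`. -/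
def tabulate : RamProg :=
  block [store table index power, div power power depth, mul power power depthSucc,
    add index index one]

/-- Tabulates the powers `(1 + 1 / m) ^ x` for `-n ≤ x < n`, shifted to start at `0` and scaled by
`((m + 1) * m) ^ n` to make them integers. -/
def initTable : RamProg :=
  block [const power 1, loop countTwice (mul power power depth), const index 0,
    loop countTwice tabulate]

/-- Appends the next binary digit of the first coordinate to `leafX`. -/
def readDigitX : RamProg := block [readX bit, add leafX leafX leafX, add leafX leafX bit]

/-- Appends the next binary digit of the second coordinate to `leafY`. -/
def readDigitY : RamProg := block [readY bit, add leafY leafY leafY, add leafY leafY bit]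

/-- Finds the grid cell of the new point. -/
def locate : RamProg :=
  block [const leafX 0, loop depth readDigitX, const leafY 0, loop depth readDigitY]

/-- Passes from `node` to the dyadic block of the next level containing it, whose array cell is
computed as `addr`, and finds the half of the block, `bit`, in which `node` lies. -/
def ascend : RamProg :=
  block [div parent node two, add double parent parent, sub bit node double,
    add addr parent offset, add offset offset width, copy node parent]

/-- Runs `P` for all dyadic blocks containing a leaf, from level `0` upwards. -/
def traverse (leaf levels : ℕ) (P : RamProg) : RamProg :=
  block [copy node leaf, const offset 0, loop levels (seq ascend P)]

/-- Adds the contribution of a block to the positive and to the negative part of the drift. -/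
def accumulate (pos neg : ℕ) : RamProg :=
  block [load plus pos addr, load minus neg addr,
    add up count plus, sub up up minus, load up table up,
    add down count minus, sub down down plus, load down table down,
    ifLt bit one (seq (add accUp accUp up) (add accDown accDown down))
      (seq (add accUp accUp down) (add accDown accDown up))]

/-- Changes the Haar coefficient of a block by the signed colour of the new point. -/
def update (pos neg : ℕ) : RamProg :=
  block [load plus pos addr, load minus neg addr,
    ifLt bit one (ifLt color one (add minus minus one) (add plus plus one))
      (ifLt color one (add plus plus one) (add minus minus one)),
    store pos addr plus, store neg addr minus]

/-- Computes the positive and the negative part of the drift at the cell of the new point. -/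
def computeDrift : RamProg :=
  block [const accUp 0, const accDown 0,
    traverse leafX depthSucc (accumulate posX negX), traverse leafY depth (accumulate posY negY)]

/-- Chooses the colour by the sign of the drift. -/
def decideColor : RamProg :=
  block [computeDrift, const color 0, ifLt accUp accDown (const color 1) skip]

/-- Adds the coloured new point to all Haar coefficients. -/
def record : RamProg :=
  seq (traverse leafX depthSucc (update posX negX)) (traverse leafY depth (update posY negY))

/-- The online colouring algorithm. The Haar coefficient of block `u` of level `i` is kept as the
difference of the cells `u + 2 ^ m * i` of two arrays, since the machine has no negative numbers. -/
def alg : OnlineAlg where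
  init := seq initDepth initTable
  step := block [locate, decideColor, record]

section Traverse

variable {P : RamProg} {σ : RamState}

theorem exec_ascend (htwo : σ.reg two = 2) :
    (ascend.exec σ).reg node = σ.reg node / 2 ∧
    (ascend.exec σ).reg offset = σ.reg offset + σ.reg width ∧
    (ascend.exec σ).reg addr = σ.reg node / 2 + σ.reg offset ∧
    (ascend.exec σ).reg bit = σ.reg node % 2 := by
  have hmod : σ.reg node - (σ.reg node / 2 + σ.reg node / 2) = σ.reg node % 2 := by omega
  simp +decide [ascend, block, exec, RamState.setReg, htwo, hmod]

theorem iterate_ascend (hP : Disjoint {two, width, node, offset} P.writes) (htwo : σ.reg two = 2)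
    (hoffset : σ.reg offset = 0) (k : ℕ) :
    let τ := (exec (seq ascend P))^[k] σ
    τ.reg two = 2 ∧ τ.reg width = σ.reg width ∧ τ.reg node = σ.reg node / 2 ^ k ∧
      τ.reg offset = σ.reg width * k := by
  induction k with
  | zero => simp [htwo, hoffset]
  | succ k ih =>
    have hframe : ∀ r ∈ ({two, width, node, offset} : Finset ℕ), ∀ ρ,
        ((seq ascend P).exec ρ).reg r = (ascend.exec ρ).reg r := fun r hr ρ =>
      exec_reg_of_notMem_writes (Finset.disjoint_left.1 hP hr) _
    simp only [Function.iterate_succ_apply'] at ih ⊢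
    generalize (exec (seq ascend P))^[k] σ = τ at ih
    obtain ⟨hτtwo, hτwidth, hτnode, hτoffset⟩ := ih
    obtain ⟨hnode, hoffset, -, -⟩ := exec_ascend hτtwo
    rw [hframe two (by decide), hframe width (by decide), hframe node (by decide),
      hframe offset (by decide), exec_reg_of_notMem_writes (by decide),
      exec_reg_of_notMem_writes (by decide), hnode, hoffset, hτnode, hτoffset, hτwidth,
      Nat.div_div_eq_div_mul, ← pow_succ, ← Nat.mul_add_one]
    exact ⟨hτtwo, rfl, rfl, rfl⟩

theorem ascend_iterate_ascend (hP : Disjoint {two, width, node, offset} P.writes)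
    (htwo : σ.reg two = 2) (hoffset : σ.reg offset = 0) (k : ℕ) :
    let τ := ascend.exec ((exec (seq ascend P))^[k] σ)
    τ.reg addr = σ.reg node / 2 ^ (k + 1) + σ.reg width * k ∧
      τ.reg bit = σ.reg node / 2 ^ k % 2 := by
  obtain ⟨hτtwo, -, hnode, hτoffset⟩ := iterate_ascend hP htwo hoffset k
  obtain ⟨-, -, haddr, hbit⟩ := exec_ascend hτtwo
  rw [hnode, hτoffset, Nat.div_div_eq_div_mul, ← pow_succ] at haddr
  rw [hnode] at hbit
  exact ⟨haddr, hbit⟩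

theorem ascend_iterate_ascend_reg {r : ℕ} (hr : r ∉ (seq ascend P).writes) (k : ℕ) :
    (ascend.exec ((exec (seq ascend P))^[k] σ)).reg r = σ.reg r :=
  (exec_reg_of_notMem_writes (fun h => hr (Finset.mem_union_left _ h)) _).trans
    (iterate_exec_reg_of_notMem_writes hr k σ)

end Traverse

/-- The Haar coefficient kept in cell `v` of the arrays `pos` and `neg`. -/
def diff (pos neg : ℕ) (σ : RamState) (v : ℕ) : ℤ := σ.arr pos v - σ.arr neg v

/-- The contribution to the drift of the Haar coefficient in cell `v`, read off the table. -/
def gap (pos neg : ℕ) (σ : RamState) (v : ℕ) : ℤ :=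
  σ.arr table (σ.reg count + σ.arr pos v - σ.arr neg v) -
    σ.arr table (σ.reg count + σ.arr neg v - σ.arr pos v)

section Visit

variable {pos neg : ℕ} {σ : RamState}

theorem exec_accumulate (hone : σ.reg one = 1) :
    let τ := (accumulate pos neg).exec σ
    (τ.reg accUp : ℤ) - τ.reg accDown = (σ.reg accUp - σ.reg accDown) +
      (if σ.reg bit = 0 then 1 else -1) * gap pos neg σ (σ.reg addr) := by
  by_cases hbit : σ.reg bit = 0 <;>
    simp +decide [accumulate, block, exec, RamState.setReg, gap, hone, hbit] <;> ring

theorem exec_update (hne : pos ≠ neg) (hone : σ.reg one = 1) (v : ℕ) :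
    diff pos neg ((update pos neg).exec σ) v = diff pos neg σ v +
      (if σ.reg color = 0 then -1 else 1) *
        if σ.reg addr = v then (if σ.reg bit = 0 then 1 else -1) else 0 := by
  by_cases hcolor : σ.reg color = 0 <;> by_cases hbit : σ.reg bit = 0 <;>
    by_cases hv : σ.reg addr = v <;>
    simp +decide [update, block, exec, RamState.setReg, RamState.setArr, diff, hone, hcolor, hbit,
      hv, hne, hne.symm, eq_comm (a := v)] <;> ring

theorem writes_accumulate :
    (accumulate pos neg).writes = {plus, minus, up, down, accUp, accDown} := by
  change (accumulate posX negX).writes = _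
  decide

theorem writes_update : (update pos neg).writes = {plus, minus} := by
  change (update posX negX).writes = _
  decide

theorem exec_traverse {leaf levels : ℕ} (hlevels : levels ∉ ({node, offset} : Finset ℕ))
    (P : RamProg) : (traverse leaf levels P).exec σ =
      (exec (seq ascend P))^[σ.reg levels] ((σ.setReg node (σ.reg leaf)).setReg offset 0) := by
  simp only [Finset.mem_insert, Finset.mem_singleton, not_or] at hlevels
  simp [traverse, block, exec, RamState.setReg, hlevels]

theorem iterate_accumulate (hone : σ.reg one = 1) (htwo : σ.reg two = 2)
    (hoffset : σ.reg offset = 0) (k : ℕ) :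
    let τ := (exec (seq ascend (accumulate pos neg)))^[k] σ
    (τ.reg accUp : ℤ) - τ.reg accDown = (σ.reg accUp - σ.reg accDown) +
      ∑ i ∈ Finset.range k, Haar.bitSign (σ.reg node) i *
        gap pos neg σ (σ.reg node / 2 ^ (i + 1) + σ.reg width * i) := by
  have hmem : ∀ r ∈ ({one, count} : Finset ℕ), r ∉ (seq ascend (accumulate pos neg)).writes := by
    rw [writes, writes_accumulate]
    decide
  induction k with
  | zero => simp
  | succ k ih =>
    obtain ⟨haddr, hbit⟩ := ascend_iterate_ascend (P := accumulate pos neg)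
      (by rw [writes_accumulate]; decide) htwo hoffset k
    have hone' := ascend_iterate_ascend_reg (σ := σ) (hmem one (by decide)) k
    have hcount := ascend_iterate_ascend_reg (σ := σ) (hmem count (by decide)) k
    have harr : ∀ a, (ascend.exec ((exec (seq ascend (accumulate pos neg)))^[k] σ)).arr a =
        σ.arr a := fun a =>
      iterate_exec_arr_of_notMem_stores (P := seq ascend (accumulate pos neg))
        (Finset.notMem_empty a) k σ
    have hvisit := exec_accumulate (pos := pos) (neg := neg) (hone'.trans hone)
    simp only [gap, harr, hcount] at hvisit
    rw [haddr, hbit, ← Haar.bitSign_eq_ite_mod,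
      exec_reg_of_notMem_writes (P := ascend) (r := accUp) (by decide),
      exec_reg_of_notMem_writes (P := ascend) (r := accDown) (by decide), ih, add_assoc] at hvisit
    rw [Function.iterate_succ_apply', Finset.sum_range_succ]
    exact hvisit

theorem iterate_update (hne : pos ≠ neg) (hone : σ.reg one = 1) (htwo : σ.reg two = 2)
    (hoffset : σ.reg offset = 0) (v k : ℕ) :
    diff pos neg ((exec (seq ascend (update pos neg)))^[k] σ) v = diff pos neg σ v +
      (if σ.reg color = 0 then -1 else 1) * ∑ i ∈ Finset.range k,
        if σ.reg node / 2 ^ (i + 1) + σ.reg width * i = v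
          then Haar.bitSign (σ.reg node) i else 0 := by
  have hmem : ∀ r ∈ ({one, color} : Finset ℕ), r ∉ (seq ascend (update pos neg)).writes := by
    rw [writes, writes_update]
    decide
  induction k with
  | zero => simp
  | succ k ih =>
    obtain ⟨haddr, hbit⟩ := ascend_iterate_ascend (P := update pos neg)
      (by rw [writes_update]; decide) htwo hoffset k
    have hone' := ascend_iterate_ascend_reg (σ := σ) (hmem one (by decide)) k
    have hcolor := ascend_iterate_ascend_reg (σ := σ) (hmem color (by decide)) k
    have hvisit := exec_update hne (hone'.trans hone) v
    rw [haddr, hbit, hcolor, ← Haar.bitSign_eq_ite_mod] at hvisit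
    rw [Function.iterate_succ_apply', Finset.sum_range_succ, mul_add, ← add_assoc, ← ih]
    exact hvisit

end Visit

theorem floor_mul_two_pow_succ (x : ℝ) (j : ℕ) :
    ⌊x * 2 ^ (j + 1)⌋₊ = 2 * ⌊x * 2 ^ j⌋₊ + (Real.digits x 2 j : ℕ) := by
  have hdiv : ⌊x * 2 ^ j⌋₊ = ⌊x * 2 ^ (j + 1)⌋₊ / 2 := by
    rw [← Nat.floor_div_ofNat]
    congr 1
    rw [pow_succ, ← mul_assoc, mul_div_cancel_right₀ _ two_ne_zero]
  have hmod : (Real.digits x 2 j : ℕ) = ⌊x * 2 ^ (j + 1)⌋₊ % 2 := by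
    simp [Real.digits, Fin.ofNat]
  omega

section Locate

variable {σ : RamState}

theorem iterate_readDigitX {x : ℝ} (hx : x ∈ Ico (0 : ℝ) 1) (htape : σ.tapeX = Real.digits x 2)
    (hleaf : σ.reg leafX = 0) (k : ℕ) :
    let τ := (exec readDigitX)^[k] σ
    τ.reg leafX = ⌊x * 2 ^ k⌋₊ ∧ τ.tapeX = (fun j => Real.digits x 2 (j + k)) ∧
      τ.tapeY = σ.tapeY := by
  induction k with
  | zero => simp [htape, hleaf, Nat.floor_eq_zero.2 hx.2]
  | succ k ih =>
    simp only [Function.iterate_succ_apply'] at ih ⊢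
    generalize (exec readDigitX)^[k] σ = τ at ih
    obtain ⟨hτleaf, hτX, hτY⟩ := ih
    rw [floor_mul_two_pow_succ, two_mul]
    simp +decide [readDigitX, block, exec, RamState.setReg, hτleaf, hτX, hτY, add_assoc, add_comm 1]

theorem iterate_readDigitY {y : ℝ} (hy : y ∈ Ico (0 : ℝ) 1) (htape : σ.tapeY = Real.digits y 2)
    (hleaf : σ.reg leafY = 0) (k : ℕ) :
    let τ := (exec readDigitY)^[k] σ
    τ.reg leafY = ⌊y * 2 ^ k⌋₊ ∧ τ.tapeY = (fun j => Real.digits y 2 (j + k)) := by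
  induction k with
  | zero => simp [htape, hleaf, Nat.floor_eq_zero.2 hy.2]
  | succ k ih =>
    simp only [Function.iterate_succ_apply'] at ih ⊢
    generalize (exec readDigitY)^[k] σ = τ at ih
    obtain ⟨hτleaf, hτY⟩ := ih
    rw [floor_mul_two_pow_succ, two_mul]
    simp +decide [readDigitY, block, exec, RamState.setReg, hτleaf, hτY, add_assoc, add_comm 1]

theorem exec_locate {z : ℝ × ℝ} (hz : z ∈ Ico (0 : ℝ) 1 ×ˢ Ico (0 : ℝ) 1) :
    let τ := locate.exec (OnlineAlg.feed z σ)
    τ.reg leafX = (cell (σ.reg depth) z).1 ∧ τ.reg leafY = (cell (σ.reg depth) z).2 := by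
  let σ₀ := exec (const leafX 0) (OnlineAlg.feed z σ)
  let σ₁ := exec (loop depth readDigitX) σ₀
  let σ₂ := exec (const leafY 0) σ₁
  have hexec : locate.exec (OnlineAlg.feed z σ) = exec (loop depth readDigitY) σ₂ := rfl
  have hdepth : σ₂.reg depth = σ.reg depth :=
    exec_reg_of_notMem_writes (P := loop depth readDigitX) (by decide) σ₀
  obtain ⟨hX, -, htape⟩ := iterate_readDigitX (σ := σ₀) hz.1 rfl rfl (σ.reg depth)
  obtain ⟨hY, -⟩ := iterate_readDigitY (σ := σ₂) hz.2 htape rfl (σ.reg depth)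
  simp only [cell]
  rw [coe_dyadic hz.1, coe_dyadic hz.2, hexec]
  refine ⟨?_, ?_⟩
  · rw [exec_reg_of_notMem_writes (by decide)]
    exact hX
  · rw [exec, hdepth]
    exact hY

end Locate

/-- What the initialization for `n` points and the grid of depth `m` leaves in the memory, apart
from the Haar coefficients. -/
structure Ready (n m : ℕ) (σ : RamState) : Prop where
  count_eq : σ.reg count = n
  one_eq : σ.reg one = 1
  two_eq : σ.reg two = 2
  depth_eq : σ.reg depth = m
  depthSucc_eq : σ.reg depthSucc = m + 1
  width_eq : σ.reg width = 2 ^ m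
  table_eq : ∀ j < 2 * n, σ.arr table j = (m + 1) ^ j * m ^ (2 * n - j)

theorem Ready.exec_of_disjoint {n m : ℕ} {σ : RamState} (h : Ready n m σ) {P : RamProg}
    (hw : Disjoint {count, one, two, depth, depthSucc, width} P.writes) (hs : table ∉ P.stores) :
    Ready n m (P.exec σ) := by
  have hreg : ∀ r ∈ ({count, one, two, depth, depthSucc, width} : Finset ℕ),
      (P.exec σ).reg r = σ.reg r :=
    fun r hr => exec_reg_of_notMem_writes (Finset.disjoint_left.1 hw hr) σ
  refine ⟨?_, ?_, ?_, ?_, ?_, ?_, ?_⟩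
  all_goals first | rw [hreg _ (by decide)] | rw [exec_arr_of_notMem_stores hs]
  exacts [h.count_eq, h.one_eq, h.two_eq, h.depth_eq, h.depthSucc_eq, h.width_eq, h.table_eq]

/-- The Haar coefficients kept in the memory. -/
def coeff (m : ℕ) (σ : RamState) : Haar.Block m → ℤ
  | .inl (i, u) => diff posX negX σ (u + 2 ^ m * i)
  | .inr (i, u) => diff posY negY σ (u + 2 ^ m * i)

theorem diff_exec_of_notMem_stores {pos neg : ℕ} {P : RamProg} (hpos : pos ∉ P.stores)
    (hneg : neg ∉ P.stores) (σ : RamState) : diff pos neg (P.exec σ) = diff pos neg σ := by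
  unfold diff
  rw [exec_arr_of_notMem_stores hpos, exec_arr_of_notMem_stores hneg]

theorem coeff_exec_of_disjoint {P : RamProg} (h : Disjoint {posX, negX, posY, negY} P.stores)
    (m : ℕ) (σ : RamState) : coeff m (P.exec σ) = coeff m σ := by
  have hframe : ∀ a ∈ ({posX, negX, posY, negY} : Finset ℕ), a ∉ P.stores :=
    fun _ ha => Finset.disjoint_left.1 h ha
  funext v
  rcases v with ⟨i, u⟩ | ⟨i, u⟩
  · exact congrFun (diff_exec_of_notMem_stores (hframe _ (by decide)) (hframe _ (by decide)) σ) _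
  · exact congrFun (diff_exec_of_notMem_stores (hframe _ (by decide)) (hframe _ (by decide)) σ) _

section Drift

variable {n m pos neg : ℕ} {σ : RamState}

theorem natCast_add_one_pow_mul_pow {j : ℕ} (hm : 0 < m) (hj : j < 2 * n) {x : ℤ}
    (hx : (j : ℤ) = n + x) :
    (((m + 1) ^ j * m ^ (2 * n - j) : ℕ) : ℝ) =
      ((m + 1) * m : ℝ) ^ n * ((m + 1) / m : ℝ) ^ x := by
  have hm0 : (m : ℝ) ≠ 0 := Nat.cast_ne_zero.2 hm.ne'
  have hm1 : (m : ℝ) + 1 ≠ 0 := by positivity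
  have hexp : ((2 * n - j : ℕ) : ℤ) = n - x := by omega
  push_cast
  rw [div_zpow, mul_pow, ← zpow_natCast, ← zpow_natCast _ (2 * n - j), hx, hexp, zpow_add₀ hm1,
    zpow_sub₀ hm0, zpow_natCast, zpow_natCast]
  field_simp

theorem Ready.gap_eq (h : Ready n m σ) (hm : 0 < m) {v : ℕ} (hv : |diff pos neg σ v| < n) :
    (gap pos neg σ v : ℝ) =
      ((m + 1) * m : ℝ) ^ n * Greedy.slope ((m + 1) / m) (diff pos neg σ v) := by
  obtain ⟨hlo, hhi⟩ := abs_lt.1 hv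
  have hdiff : diff pos neg σ v = σ.arr pos v - σ.arr neg v := rfl
  have hup : n + σ.arr pos v - σ.arr neg v < 2 * n := by omega
  have hdown : n + σ.arr neg v - σ.arr pos v < 2 * n := by omega
  rw [gap, h.count_eq, h.table_eq _ hup, h.table_eq _ hdown, Int.cast_sub, Int.cast_natCast,
    Int.cast_natCast, natCast_add_one_pow_mul_pow hm hup (x := diff pos neg σ v) (by omega),
    natCast_add_one_pow_mul_pow hm hdown (x := -diff pos neg σ v) (by omega), Greedy.slope, mul_sub]

theorem Ready.sum_gap (h : Ready n m σ) (hm : 0 < m) {k : ℕ}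
    (hσ : ∀ (i : Fin k) (u : Fin (2 ^ m)), |diff pos neg σ (u + 2 ^ m * i)| < n)
    (w : Fin (2 ^ m)) :
    ∑ i ∈ Finset.range k, (Haar.bitSign w i * gap pos neg σ (w / 2 ^ (i + 1) + 2 ^ m * i) : ℝ) =
      ((m + 1) * m : ℝ) ^ n * ∑ i : Fin k, ∑ u : Fin (2 ^ m),
        Haar.haar i u w * Greedy.slope ((m + 1) / m) (diff pos neg σ (u + 2 ^ m * i)) := by
  rw [← Fin.sum_univ_eq_sum_range (fun i => (Haar.bitSign w i *
    gap pos neg σ (w / 2 ^ (i + 1) + 2 ^ m * i) : ℝ)), Finset.mul_sum]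
  refine Finset.sum_congr rfl fun i _ => ?_
  simp only [Haar.haar, Int.cast_ite, Int.cast_zero, ite_mul, zero_mul]
  rw [Haar.sum_ite_block i w fun u => (Haar.bitSign w i : ℝ) *
    Greedy.slope ((m + 1) / m) (diff pos neg σ (u + 2 ^ m * i)),
    h.gap_eq hm (hσ i ⟨_, Haar.div_two_pow_lt w.2 _⟩)]
  ring

theorem Ready.exec_traverse_accumulate (h : Ready n m σ) (hm : 0 < m) {leaf levels k : ℕ}
    (hlevels : levels ∉ ({node, offset} : Finset ℕ)) (hk : σ.reg levels = k) {w : Fin (2 ^ m)}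
    (hleaf : σ.reg leaf = w)
    (hσ : ∀ (i : Fin k) (u : Fin (2 ^ m)), |diff pos neg σ (u + 2 ^ m * i)| < n) :
    let τ := (traverse leaf levels (accumulate pos neg)).exec σ
    (τ.reg accUp - τ.reg accDown : ℝ) = (σ.reg accUp - σ.reg accDown) +
      ((m + 1) * m : ℝ) ^ n * ∑ i : Fin k, ∑ u : Fin (2 ^ m),
        Haar.haar i u w * Greedy.slope ((m + 1) / m) (diff pos neg σ (u + 2 ^ m * i)) := by
  have hacc := iterate_accumulate (pos := pos) (neg := neg)
    (σ := (σ.setReg node (σ.reg leaf)).setReg offset 0) h.one_eq h.two_eq rfl k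
  rw [← h.sum_gap hm hσ w, exec_traverse hlevels, hk, ← hleaf, ← h.width_eq]
  exact_mod_cast congrArg (Int.cast : ℤ → ℝ) hacc

theorem Ready.exec_computeDrift (h : Ready n m σ) (hm : 0 < m) {z : Fin (2 ^ m) × Fin (2 ^ m)}
    (hX : σ.reg leafX = z.1) (hY : σ.reg leafY = z.2) (hσ : ∀ v, |coeff m σ v| < n) :
    let τ := computeDrift.exec σ
    (τ.reg accUp - τ.reg accDown : ℝ) =
      ((m + 1) * m : ℝ) ^ n * Greedy.drift (Haar.gridHaar m) ((m + 1) / m) (coeff m σ) z := by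
  let σ₀ := (block [const accUp 0, const accDown 0]).exec σ
  let σ₁ := (traverse leafX depthSucc (accumulate posX negX)).exec σ₀
  have hσ₀ : Ready n m σ₀ := h.exec_of_disjoint (by decide) (by decide)
  have hσ₁ : Ready n m σ₁ := hσ₀.exec_of_disjoint (by decide) (by decide)
  have hleaf : σ₁.reg leafY = z.2 := (exec_reg_of_notMem_writes (by decide) σ₀).trans hY
  have haccX := hσ₀.exec_traverse_accumulate hm (pos := posX) (neg := negX)
    (leaf := leafX) (by decide) hσ₀.depthSucc_eq hX fun i u => hσ (.inl (i, u))
  have hdiffY : diff posY negY σ₁ = diff posY negY σ :=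
    diff_exec_of_notMem_stores (by decide) (by decide) σ₀
  have haccY := hσ₁.exec_traverse_accumulate hm (pos := posY) (neg := negY)
    (leaf := leafY) (by decide) hσ₁.depth_eq hleaf fun i u => by rw [hdiffY]; exact hσ (.inr (i, u))
  have hstart : (σ₀.reg accUp - σ₀.reg accDown : ℝ) = 0 := sub_self _
  rw [haccX, hstart, hdiffY, zero_add, ← mul_add] at haccY
  rw [Greedy.drift, Fintype.sum_sum_type, Fintype.sum_prod_type, Fintype.sum_prod_type]
  exact haccY

theorem Ready.exec_decideColor (h : Ready n m σ) (hm : 0 < m) {z : Fin (2 ^ m) × Fin (2 ^ m)}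
    (hX : σ.reg leafX = z.1) (hY : σ.reg leafY = z.2) (hσ : ∀ v, |coeff m σ v| < n) :
    (if (decideColor.exec σ).reg color = 0 then -1 else 1) =
      Greedy.sign (Haar.gridHaar m) ((m + 1) / m) (coeff m σ) z := by
  have hdrift := h.exec_computeDrift hm hX hY hσ
  have hneg : (computeDrift.exec σ).reg accUp < (computeDrift.exec σ).reg accDown ↔
      Greedy.drift (Haar.gridHaar m) ((m + 1) / m) (coeff m σ) z < 0 := by
    rw [← Nat.cast_lt (α := ℝ), ← sub_neg, hdrift, mul_neg_iff]
    have : (0 : ℝ) < ((m + 1) * m : ℝ) ^ n := by positivity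
    simp [this, this.le]
  simp only [Greedy.sign, ← hneg]
  by_cases hlt : (computeDrift.exec σ).reg accUp < (computeDrift.exec σ).reg accDown <;>
    simp +decide [decideColor, block, exec, RamState.setReg, hlt]

end Drift

section Step

variable {n m pos neg : ℕ} {σ : RamState}

theorem sum_range_ite_address {k : ℕ} (w u : Fin (2 ^ m)) (i : Fin k) :
    (∑ j ∈ Finset.range k, if (w : ℕ) / 2 ^ (j + 1) + 2 ^ m * j = u + 2 ^ m * i
      then Haar.bitSign w j else 0) = Haar.haar i u w := by
  have haddr (j : ℕ) : (w : ℕ) / 2 ^ (j + 1) + 2 ^ m * j = u + 2 ^ m * i ↔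
      j = i ∧ (w : ℕ) / 2 ^ (i + 1 : ℕ) = u := by
    have hlt := Haar.div_two_pow_lt w.2 (j + 1)
    refine ⟨fun h => ?_, fun ⟨hj, hw⟩ => by rw [hj, hw]⟩
    have hj : j = i := by
      have hdiv := congrArg (· / 2 ^ m) h
      simpa [Nat.add_mul_div_left, Nat.div_eq_of_lt hlt, Nat.div_eq_of_lt u.2] using hdiv
    subst hj
    exact ⟨rfl, Nat.add_right_cancel h⟩
  simp only [haddr, ite_and, Finset.sum_ite_eq', Finset.mem_range, i.2, if_true, Haar.haar]

theorem Ready.exec_traverse_update (h : Ready n m σ) (hne : pos ≠ neg) {leaf levels k : ℕ}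
    (hlevels : levels ∉ ({node, offset} : Finset ℕ)) (hk : σ.reg levels = k) {w : Fin (2 ^ m)}
    (hleaf : σ.reg leaf = w) (i : Fin k) (u : Fin (2 ^ m)) :
    diff pos neg ((traverse leaf levels (update pos neg)).exec σ) (u + 2 ^ m * i) =
      diff pos neg σ (u + 2 ^ m * i) +
        (if σ.reg color = 0 then -1 else 1) * Haar.haar i u w := by
  let σ₀ := (σ.setReg node (σ.reg leaf)).setReg offset 0
  have hnode : σ₀.reg node = w := hleaf
  have hwidth : σ₀.reg width = 2 ^ m := h.width_eq
  have hupdate := iterate_update (σ := σ₀) hne h.one_eq h.two_eq rfl (u + 2 ^ m * i) k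
  rw [hnode, hwidth, sum_range_ite_address] at hupdate
  rw [exec_traverse hlevels, hk]
  exact hupdate

theorem Ready.coeff_record (h : Ready n m σ) {z : Fin (2 ^ m) × Fin (2 ^ m)}
    (hX : σ.reg leafX = z.1) (hY : σ.reg leafY = z.2) (v : Haar.Block m) :
    coeff m (record.exec σ) v =
      coeff m σ v + (if σ.reg color = 0 then -1 else 1) * Haar.gridHaar m z v := by
  let σ₁ := (traverse leafX depthSucc (update posX negX)).exec σ
  have hσ₁ : Ready n m σ₁ := h.exec_of_disjoint (by decide) (by decide)
  have hleaf : σ₁.reg leafY = z.2 := (exec_reg_of_notMem_writes (by decide) σ).trans hY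
  have hcolor : σ₁.reg color = σ.reg color := exec_reg_of_notMem_writes (by decide) σ
  have hX₁ := h.exec_traverse_update (pos := posX) (neg := negX) (leaf := leafX)
    (levels := depthSucc) (by decide) (by decide) h.depthSucc_eq hX
  have hY₁ := hσ₁.exec_traverse_update (pos := posY) (neg := negY) (leaf := leafY)
    (levels := depth) (by decide) (by decide) hσ₁.depth_eq hleaf
  rw [hcolor] at hY₁
  rcases v with ⟨i, u⟩ | ⟨i, u⟩
  · have hframe : diff posX negX (record.exec σ) = diff posX negX σ₁ :=
      diff_exec_of_notMem_stores (by decide) (by decide) σ₁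
    exact (congrFun hframe _).trans (hX₁ i u)
  · have hframe : diff posY negY σ₁ = diff posY negY σ :=
      diff_exec_of_notMem_stores (by decide) (by decide) σ
    rw [hframe] at hY₁
    exact hY₁ i u

theorem Ready.exec_step (h : Ready n m σ) (hm : 0 < m) (hσ : ∀ v, |coeff m σ v| < n)
    {z : ℝ × ℝ} (hz : z ∈ Ico (0 : ℝ) 1 ×ˢ Ico (0 : ℝ) 1) :
    let τ := alg.step.exec (OnlineAlg.feed z σ)
    let e := Greedy.sign (Haar.gridHaar m) ((m + 1) / m) (coeff m σ) (cell m z)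
    Ready n m τ ∧ (if τ.reg color = 0 then -1 else 1) = e ∧
      coeff m τ = Greedy.next (Haar.gridHaar m) ((m + 1) / m) (coeff m σ) (cell m z) := by
  let σ₁ := locate.exec (OnlineAlg.feed z σ)
  let σ₂ := decideColor.exec σ₁
  have hfeed : Ready n m (OnlineAlg.feed z σ) :=
    ⟨h.count_eq, h.one_eq, h.two_eq, h.depth_eq, h.depthSucc_eq, h.width_eq, h.table_eq⟩
  have hσ₁ : Ready n m σ₁ := hfeed.exec_of_disjoint (by decide) (by decide)
  have hσ₂ : Ready n m σ₂ := hσ₁.exec_of_disjoint (by decide) (by decide)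
  have hcoeff₁ : coeff m σ₁ = coeff m σ := coeff_exec_of_disjoint (P := locate) (by decide) m _
  have hcoeff₂ : coeff m σ₂ = coeff m σ :=
    (coeff_exec_of_disjoint (P := decideColor) (by decide) m _).trans hcoeff₁
  obtain ⟨hX, hY⟩ := exec_locate (σ := σ) hz
  rw [h.depth_eq] at hX hY
  have hsign := hσ₁.exec_decideColor hm hX hY (by rwa [hcoeff₁])
  rw [hcoeff₁] at hsign
  have hX₂ : σ₂.reg leafX = (cell m z).1 := (exec_reg_of_notMem_writes (by decide) σ₁).trans hX
  have hY₂ : σ₂.reg leafY = (cell m z).2 := (exec_reg_of_notMem_writes (by decide) σ₁).trans hY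
  refine ⟨hσ₂.exec_of_disjoint (P := record) (by decide) (by decide), ?_, ?_⟩
  · rw [← hsign, show alg.step.exec (OnlineAlg.feed z σ) = record.exec σ₂ from rfl,
      exec_reg_of_notMem_writes (by decide)]
  · funext v
    rw [Greedy.next, ← hsign, ← hcoeff₂]
    exact hσ₂.coeff_record hX₂ hY₂ v

end Step

section Init

theorem exec_grow {σ : RamState} {n k : ℕ} (hcount : σ.reg count = n) (hone : σ.reg one = 1)
    (hdepth : σ.reg depth = min k (Nat.clog 2 n))
    (hwidth : σ.reg width = 2 ^ min k (Nat.clog 2 n)) :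
    (grow.exec σ).reg depth = min (k + 1) (Nat.clog 2 n) ∧
      (grow.exec σ).reg width = 2 ^ min (k + 1) (Nat.clog 2 n) := by
  by_cases hk : k < Nat.clog 2 n
  · have hlt : 2 ^ k < n := (Nat.lt_clog_iff_pow_lt one_lt_two).1 hk
    rw [min_eq_left hk.le] at hdepth hwidth
    rw [min_eq_left (Nat.succ_le_of_lt hk), pow_succ, mul_two]
    simp +decide [grow, exec, RamState.setReg, hcount, hone, hdepth, hwidth, hlt]
  · have hle : Nat.clog 2 n ≤ k := not_lt.1 hk
    have hnlt : ¬ 2 ^ Nat.clog 2 n < n := (Nat.le_pow_clog one_lt_two n).not_gt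
    rw [min_eq_right hle] at hdepth hwidth
    rw [min_eq_right (hle.trans k.le_succ)]
    simp [grow, exec, hcount, hdepth, hwidth, hnlt]

theorem iterate_grow {σ : RamState} {n : ℕ} (hcount : σ.reg count = n) (hone : σ.reg one = 1)
    (hdepth : σ.reg depth = 0) (hwidth : σ.reg width = 1) (k : ℕ) :
    let τ := (exec grow)^[k] σ
    τ.reg depth = min k (Nat.clog 2 n) ∧ τ.reg width = 2 ^ min k (Nat.clog 2 n) := by
  induction k with
  | zero => simp [hdepth, hwidth]
  | succ k ih =>
    simp only [Function.iterate_succ_apply'] at ih ⊢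
    exact exec_grow ((iterate_exec_reg_of_notMem_writes (by decide) k σ).trans hcount)
      ((iterate_exec_reg_of_notMem_writes (by decide) k σ).trans hone) ih.1 ih.2

theorem clog_two_le_self (n : ℕ) : Nat.clog 2 n ≤ n :=
  Nat.clog_le_of_le_pow Nat.lt_two_pow_self.le

theorem exec_initDepth (n : ℕ) :
    let τ := initDepth.exec (OnlineAlg.start n)
    τ.reg count = n ∧ τ.reg one = 1 ∧ τ.reg two = 2 ∧ τ.reg depth = Nat.clog 2 n ∧
      τ.reg depthSucc = Nat.clog 2 n + 1 ∧ τ.reg width = 2 ^ Nat.clog 2 n ∧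
      τ.reg countTwice = 2 * n := by
  let σ₀ := (block [const one 1, const two 2, const depth 0, const width 1]).exec
    (OnlineAlg.start n)
  let σ₁ := (exec grow)^[n] σ₀
  have hframe : ∀ r ∉ grow.writes, σ₁.reg r = σ₀.reg r := fun r hr =>
    iterate_exec_reg_of_notMem_writes hr n σ₀
  have hcount : σ₁.reg count = n := hframe count (by decide)
  have hone : σ₁.reg one = 1 := hframe one (by decide)
  have htwo : σ₁.reg two = 2 := hframe two (by decide)
  obtain ⟨hdepth, hwidth⟩ := iterate_grow (σ := σ₀) (n := n) rfl rfl rfl rfl n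
  rw [min_eq_right (clog_two_le_self n)] at hdepth hwidth
  have hexec : initDepth.exec (OnlineAlg.start n) =
      (block [add depthSucc depth one, add countTwice count count]).exec σ₁ := rfl
  rw [hexec, two_mul]
  simp only [← show σ₁ = (exec grow)^[n] σ₀ from rfl] at hdepth hwidth
  simp +decide [block, exec, RamState.setReg, hcount, hone, htwo, hdepth, hwidth]

theorem iterate_mul_power {m : ℕ} {σ : RamState} (hdepth : σ.reg depth = m)
    (hpower : σ.reg power = 1) (k : ℕ) :
    ((exec (mul power power depth))^[k] σ).reg power = m ^ k := by
  induction k with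
  | zero => exact hpower
  | succ k ih =>
    have hτ := (iterate_exec_reg_of_notMem_writes (P := mul power power depth) (r := depth)
      (by decide) k σ).trans hdepth
    rw [Function.iterate_succ_apply']
    generalize (exec (mul power power depth))^[k] σ = τ at ih hτ
    simp [exec, RamState.setReg, ih, hτ, pow_succ]

theorem exec_tabulate {m N k : ℕ} (hm : 0 < m) (hk : k < N) {σ : RamState}
    (hone : σ.reg one = 1) (hdepth : σ.reg depth = m) (hdepthSucc : σ.reg depthSucc = m + 1)
    (hpower : σ.reg power = (m + 1) ^ k * m ^ (N - k)) (hindex : σ.reg index = k) :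
    let τ := tabulate.exec σ
    τ.reg power = (m + 1) ^ (k + 1) * m ^ (N - (k + 1)) ∧ τ.reg index = k + 1 ∧
      τ.arr table = Function.update (σ.arr table) k ((m + 1) ^ k * m ^ (N - k)) := by
  have hdiv : (m + 1) ^ k * m ^ (N - k) / m = (m + 1) ^ k * m ^ (N - (k + 1)) := by
    rw [show N - k = N - (k + 1) + 1 by omega, pow_succ, ← mul_assoc, Nat.mul_div_cancel _ hm]
  simp +decide [tabulate, block, exec, RamState.setReg, RamState.setArr, hone, hdepth, hdepthSucc,
    hpower, hindex, hdiv]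
  ring

theorem iterate_tabulate {m N : ℕ} (hm : 0 < m) {σ : RamState} (hone : σ.reg one = 1)
    (hdepth : σ.reg depth = m) (hdepthSucc : σ.reg depthSucc = m + 1)
    (hpower : σ.reg power = m ^ N) (hindex : σ.reg index = 0) {k : ℕ} (hk : k ≤ N) :
    let τ := (exec tabulate)^[k] σ
    τ.reg power = (m + 1) ^ k * m ^ (N - k) ∧ τ.reg index = k ∧
      ∀ j < k, τ.arr table j = (m + 1) ^ j * m ^ (N - j) := by
  induction k with
  | zero => simp [hpower, hindex]
  | succ k ih =>
    have hframe : ∀ r ∉ tabulate.writes, ((exec tabulate)^[k] σ).reg r = σ.reg r := fun r hr =>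
      iterate_exec_reg_of_notMem_writes hr k σ
    obtain ⟨hτpower, hτindex, hτtable⟩ := ih (Nat.le_of_succ_le hk)
    obtain ⟨hpower', hindex', htable'⟩ := exec_tabulate hm hk
      ((hframe one (by decide)).trans hone) ((hframe depth (by decide)).trans hdepth)
      ((hframe depthSucc (by decide)).trans hdepthSucc) hτpower hτindex
    simp only [Function.iterate_succ_apply']
    refine ⟨hpower', hindex', fun j hj => ?_⟩
    rw [htable']
    rcases (Nat.lt_succ_iff.1 hj).eq_or_lt with rfl | hlt
    · exact Function.update_self ..
    · rw [Function.update_of_ne hlt.ne]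
      exact hτtable j hlt

theorem exec_initTable {m N : ℕ} (hm : 0 < m) {σ : RamState} (hone : σ.reg one = 1)
    (hdepth : σ.reg depth = m) (hdepthSucc : σ.reg depthSucc = m + 1)
    (hcountTwice : σ.reg countTwice = N) :
    ∀ j < N, (initTable.exec σ).arr table j = (m + 1) ^ j * m ^ (N - j) := by
  let P := block [const power 1, loop countTwice (mul power power depth), const index 0]
  have hframe : ∀ r ∉ P.writes, (P.exec σ).reg r = σ.reg r := fun r hr =>
    exec_reg_of_notMem_writes hr σ
  have hpower : (P.exec σ).reg power = m ^ N := by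
    rw [← hcountTwice]
    exact iterate_mul_power (σ := σ.setReg power 1) hdepth rfl (σ.reg countTwice)
  have htable := (iterate_tabulate hm ((hframe one (by decide)).trans hone)
    ((hframe depth (by decide)).trans hdepth) ((hframe depthSucc (by decide)).trans hdepthSucc)
    hpower rfl le_rfl).2.2
  have hexec : initTable.exec σ = exec (loop countTwice tabulate) (P.exec σ) := rfl
  rw [hexec, exec, hframe countTwice (by decide), hcountTwice]
  exact htable

theorem ready_init {n : ℕ} (hn : 2 ≤ n) :
    Ready n (Nat.clog 2 n) (alg.init.exec (OnlineAlg.start n)) := by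
  obtain ⟨hcount, hone, htwo, hdepth, hdepthSucc, hwidth, hcountTwice⟩ := exec_initDepth n
  have hframe : ∀ r ∉ initTable.writes, (alg.init.exec (OnlineAlg.start n)).reg r =
      (initDepth.exec (OnlineAlg.start n)).reg r := fun r hr => exec_reg_of_notMem_writes hr _
  exact ⟨(hframe _ (by decide)).trans hcount, (hframe _ (by decide)).trans hone,
    (hframe _ (by decide)).trans htwo, (hframe _ (by decide)).trans hdepth,
    (hframe _ (by decide)).trans hdepthSucc, (hframe _ (by decide)).trans hwidth,
    exec_initTable (Nat.clog_pos one_lt_two hn) hone hdepth hdepthSucc hcountTwice⟩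

theorem coeff_init (m n : ℕ) : coeff m (alg.init.exec (OnlineAlg.start n)) = 0 := by
  rw [coeff_exec_of_disjoint (by decide)]
  funext v
  rcases v with v | v <;> exact sub_self _

end Init

section StateAfter

variable {n : ℕ} {l : List (ℝ × ℝ)}

theorem abs_run_map_cell_lt (m : ℕ) (r : ℝ) (hl : l.length < n) (v : Haar.Block m) :
    |Greedy.run (Haar.gridHaar m) r 0 (l.map (cell m)) v| < n := by
  have hle := Greedy.abs_run_le_length (r := r) (Haar.isSparseOrthogonal_gridHaar m).abs_le_one
    (l.map (cell m)) v
  rw [List.length_map] at hle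
  omega

theorem ready_stateAfter (hn : 2 ≤ n) (hl : l.length ≤ n)
    (hmem : ∀ z ∈ l, z ∈ Ico (0 : ℝ) 1 ×ˢ Ico (0 : ℝ) 1) :
    let m := Nat.clog 2 n
    Ready n m (alg.stateAfter n l) ∧ coeff m (alg.stateAfter n l) =
      Greedy.run (Haar.gridHaar m) ((m + 1) / m) 0 (l.map (cell m)) := by
  induction l using List.reverseRecOn with
  | nil => exact ⟨ready_init hn, coeff_init _ n⟩
  | append_singleton l z ih =>
    rw [List.length_append, List.length_singleton] at hl
    obtain ⟨hready, hcoeff⟩ := ih (by omega) fun w hw => hmem w (List.mem_append_left _ hw)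
    obtain ⟨hready', -, hcoeff'⟩ := hready.exec_step (Nat.clog_pos one_lt_two hn)
      (by rw [hcoeff]; exact abs_run_map_cell_lt _ _ (by omega)) (hmem z (by simp))
    rw [OnlineAlg.stateAfter_append_singleton]
    refine ⟨hready', hcoeff'.trans ?_⟩
    rw [hcoeff, List.map_append, Greedy.run, Greedy.run, List.foldl_append]
    rfl

theorem coeff_stateAfter_append_singleton (hn : 2 ≤ n) (hl : l.length < n) {z : ℝ × ℝ}
    (hmem : ∀ w ∈ l ++ [z], w ∈ Ico (0 : ℝ) 1 ×ˢ Ico (0 : ℝ) 1) :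
    let m := Nat.clog 2 n
    let τ := alg.stateAfter n (l ++ [z])
    ∀ v, coeff m τ v = coeff m (alg.stateAfter n l) v +
      (if τ.reg color = 0 then -1 else 1) * Haar.gridHaar m (cell m z) v := by
  obtain ⟨hready, hcoeff⟩ := ready_stateAfter hn hl.le fun w hw =>
    hmem w (List.mem_append_left _ hw)
  obtain ⟨-, hcolor, hcoeff'⟩ := hready.exec_step (Nat.clog_pos one_lt_two hn)
    (by rw [hcoeff]; exact abs_run_map_cell_lt _ _ hl) (hmem z (by simp))
  intro m τ v
  simp only [τ, OnlineAlg.stateAfter_append_singleton]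
  rw [hcoeff', hcolor]
  rfl

theorem sum_color_mul_gridHaar (hn : 2 ≤ n) {p : Fin n → ℝ × ℝ}
    (hp : ∀ t, p t ∈ Ico (0 : ℝ) 1 ×ˢ Ico (0 : ℝ) 1) :
    let m := Nat.clog 2 n
    ∀ v, ∑ t, alg.color p t * Haar.gridHaar m (cell m (p t)) v =
      Greedy.run (Haar.gridHaar m) ((m + 1) / m) 0 (List.ofFn fun t => cell m (p t)) v := by
  intro m v
  have hmem : ∀ z ∈ List.ofFn p, z ∈ Ico (0 : ℝ) 1 ×ˢ Ico (0 : ℝ) 1 := by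
    simpa only [List.forall_mem_ofFn_iff] using hp
  let F (t : ℕ) : ℤ := coeff m (alg.stateAfter n ((List.ofFn p).take t)) v
  have hstep (t : Fin n) :
      alg.color p t * Haar.gridHaar m (cell m (p t)) v = F (t + 1) - F t := by
    have htake : (List.ofFn p).take (t + 1) = (List.ofFn p).take t ++ [p t] := by
      rw [List.take_succ_eq_append_getElem (by simp), List.getElem_ofFn]
    have hone := coeff_stateAfter_append_singleton hn (l := (List.ofFn p).take t) (z := p t)
      (by simp) (fun w hw => hmem w (List.mem_of_mem_take (htake ▸ hw))) v
    rw [← htake] at hone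
    exact eq_sub_of_add_eq' hone.symm
  have hF : F n = Greedy.run (Haar.gridHaar m) ((m + 1) / m) 0 ((List.ofFn p).map (cell m)) v := by
    simp only [F]
    rw [List.take_of_length_le (by simp), (ready_stateAfter hn (by simp) hmem).2]
  have hF₀ : F 0 = 0 := congrFun (coeff_init m n) v
  rw [Finset.sum_congr rfl fun t _ => hstep t,
    Fin.sum_univ_eq_sum_range (fun t => F (t + 1) - F t), Finset.sum_range_sub, hF, hF₀, sub_zero,
    List.map_ofFn]
  rfl

end StateAfter

section Time

open OnlineAlg Polynomial

theorem runsWithin_init (n : ℕ) : RunsWithin alg.init (start n) n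
    ((initDepth.cost + initTable.cost.comp (2 * X + 1)).eval n) := by
  obtain ⟨-, -, -, hdepth, hdepthSucc, -, hcountTwice⟩ := exec_initDepth n
  have hclog := clog_two_le_self n
  have hgrid : RunsWithin initDepth (start n) n (initDepth.cost.eval n) :=
    runsWithin_of_guardedBy (R := {count}) (by simp [initDepth, grow, block, GuardedBy])
      (by decide) (sizeLE_start n) (by simp [start])
  have htable : RunsWithin initTable (initDepth.exec (start n)) (n + initDepth.cost.eval n)
      (initTable.cost.eval (2 * n + 1)) := by
    refine runsWithin_of_guardedBy (R := {depth, depthSucc, countTwice})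
      (by simp [initTable, tabulate, block, GuardedBy]) (by decide) hgrid.1 ?_
    simp only [Finset.mem_insert, Finset.mem_singleton, forall_eq_or_imp, forall_eq, hdepth,
      hdepthSucc, hcountTwice]
    omega
  simpa [alg] using hgrid.seq htable

theorem isPolyTime_alg : alg.IsPolyTime := by
  refine isPolyTime_of_guardedBy (R := {depth, depthSucc}) (B := X + 1) runsWithin_init
    (fun n => ?_) ?_ (by decide)
  · obtain ⟨-, -, -, hdepth, hdepthSucc, -, -⟩ := exec_initDepth n
    have hclog := clog_two_le_self n
    have hframe : ∀ r ∉ initTable.writes, (alg.init.exec (start n)).reg r =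
        (initDepth.exec (start n)).reg r := fun r hr => exec_reg_of_notMem_writes hr _
    simp only [Finset.mem_insert, Finset.mem_singleton, forall_eq_or_imp, forall_eq, eval_add,
      eval_X, eval_one, hframe depth (by decide), hframe depthSucc (by decide), hdepth, hdepthSucc]
    omega
  · simp [alg, locate, readDigitX, readDigitY, decideColor, computeDrift, record, traverse, ascend,
      accumulate, update, block, GuardedBy]

end Time

end StripeAlg

section Uniform

variable {n m : ℕ}

theorem Ico_inter_dyadic_preimage (m : ℕ) (u : Fin (2 ^ m)) :
    Ico (0 : ℝ) 1 ∩ dyadic m ⁻¹' {u} = Ico ((u : ℝ) / 2 ^ m) ((u + 1) / 2 ^ m) := by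
  have hpow : (0 : ℝ) < 2 ^ m := by positivity
  have hu : (u + 1 : ℝ) ≤ 2 ^ m := by exact_mod_cast u.2
  have hfloor {x : ℝ} (hx : 0 ≤ x) :
      ⌊x * 2 ^ m⌋₊ = u ↔ x ∈ Ico ((u : ℝ) / 2 ^ m) ((u + 1) / 2 ^ m) := by
    rw [Nat.floor_eq_iff (by positivity), mem_Ico, div_le_iff₀ hpow, lt_div_iff₀ hpow]
  ext x
  simp only [mem_inter_iff, mem_preimage, mem_singleton_iff]
  constructor
  · rintro ⟨hx, rfl⟩
    exact (hfloor hx.1).1 (coe_dyadic hx m).symm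
  · intro hx
    have hx₀ : 0 ≤ x := hx.1.trans' (by positivity)
    have hx₁ : x < 1 := hx.2.trans_le ((div_le_one hpow).2 hu)
    exact ⟨⟨hx₀, hx₁⟩, Fin.ext ((coe_dyadic ⟨hx₀, hx₁⟩ m).trans ((hfloor hx₀).2 hx))⟩

theorem volume_restrict_cell_eq_le (m : ℕ) (z : Fin (2 ^ m) × Fin (2 ^ m)) :
    (volume : Measure (ℝ × ℝ)).restrict (Icc 0 1 ×ˢ Icc 0 1)
      {q | q ∈ Ico (0 : ℝ) 1 ×ˢ Ico (0 : ℝ) 1 ∧ cell m q = z} ≤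
      ENNReal.ofReal (1 / (2 ^ m * 2 ^ m)) := by
  have hset : {q : ℝ × ℝ | q ∈ Ico (0 : ℝ) 1 ×ˢ Ico (0 : ℝ) 1 ∧ cell m q = z} =
      Ico ((z.1 : ℝ) / 2 ^ m) ((z.1 + 1) / 2 ^ m) ×ˢ
        Ico ((z.2 : ℝ) / 2 ^ m) ((z.2 + 1) / 2 ^ m) := by
    rw [← Ico_inter_dyadic_preimage, ← Ico_inter_dyadic_preimage]
    ext q
    simp only [mem_ofPred_eq, mem_prod, mem_inter_iff, mem_preimage, mem_singleton_iff, cell,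
      Prod.ext_iff]
    tauto
  refine (Measure.restrict_apply_le _ _).trans_eq ?_
  rw [hset, Measure.volume_eq_prod, Measure.prod_prod, Real.volume_Ico, Real.volume_Ico,
    ← ENNReal.ofReal_mul (by rw [← sub_div]; simp)]
  congr 1
  ring

theorem ae_mem_Ico (n : ℕ) :
    ∀ᵐ p ∂uniformPoints n, ∀ t, p t ∈ Ico (0 : ℝ) 1 ×ˢ Ico (0 : ℝ) 1 := by
  have hsquare : Icc (0 : ℝ) 1 ×ˢ Icc (0 : ℝ) 1 =ᵐ[volume] Ico (0 : ℝ) 1 ×ˢ Ico (0 : ℝ) 1 := by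
    rw [Measure.volume_eq_prod]
    exact (Measure.set_prod_ae_eq Ico_ae_eq_Icc Ico_ae_eq_Icc).symm
  have hpoint : ∀ᵐ q ∂(volume : Measure (ℝ × ℝ)).restrict (Icc 0 1 ×ˢ Icc 0 1),
      q ∈ Ico (0 : ℝ) 1 ×ˢ Ico (0 : ℝ) 1 := by
    rw [Measure.restrict_congr_set hsquare]
    exact ae_restrict_mem (measurableSet_Ico.prod measurableSet_Ico)
  exact Filter.eventually_all.2 fun t => (Measure.tendsto_eval_ae_ae (i := t)).eventually hpoint

theorem uniformPoints_cell_mem_le {B : Finset (Fin n → Fin (2 ^ m) × Fin (2 ^ m))} {ε : ℝ}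
    (hB : (B.card : ℝ) ≤ (2 ^ m * 2 ^ m) ^ n * ε) :
    uniformPoints n {p | (fun t => cell m (p t)) ∈ B} ≤ ENNReal.ofReal ε := by
  let box (c : Fin n → Fin (2 ^ m) × Fin (2 ^ m)) : Set (Fin n → ℝ × ℝ) :=
    univ.pi fun t => {q | q ∈ Ico (0 : ℝ) 1 ×ˢ Ico (0 : ℝ) 1 ∧ cell m q = c t}
  have hbox (c) : uniformPoints n (box c) ≤ ENNReal.ofReal (1 / (2 ^ m * 2 ^ m) ^ n) := by
    rw [uniformPoints, Measure.pi_pi]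
    refine (Finset.prod_le_prod' fun t _ => volume_restrict_cell_eq_le m (c t)).trans_eq ?_
    rw [Finset.prod_const, Finset.card_univ, Fintype.card_fin,
      ← ENNReal.ofReal_pow (by positivity), div_pow, one_pow]
  calc uniformPoints n {p | (fun t => cell m (p t)) ∈ B}
    _ ≤ uniformPoints n (⋃ c ∈ B, box c) := by
        refine measure_mono_ae ?_
        filter_upwards [ae_mem_Ico n] with p hp hB
        exact mem_biUnion hB fun t _ => ⟨hp t, rfl⟩
    _ ≤ ∑ c ∈ B, uniformPoints n (box c) := measure_biUnion_finset_le _ _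
    _ ≤ B.card • ENNReal.ofReal (1 / (2 ^ m * 2 ^ m) ^ n) :=
        Finset.sum_le_card_nsmul _ _ _ fun c _ => hbox c
    _ = ENNReal.ofReal (B.card / (2 ^ m * 2 ^ m) ^ n) := by
        rw [nsmul_eq_mul, ← ENNReal.ofReal_natCast, ← ENNReal.ofReal_mul (by positivity),
          mul_one_div]
    _ ≤ ENNReal.ofReal ε :=
        ENNReal.ofReal_le_ofReal ((div_le_iff₀' (by positivity)).2 hB)

end Uniform

section Tail

variable {n m : ℕ}

theorem two_le_add_one_div_pow (hm : 0 < m) : (2 : ℝ) ≤ ((m + 1) / m) ^ m := by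
  have hm' : (0 : ℝ) < m := by exact_mod_cast hm
  have hbernoulli := one_add_mul_le_pow (a := (1 / m : ℝ)) (by linarith [one_div_pos.2 hm']) m
  rw [mul_one_div_cancel hm'.ne', one_add_one_eq_two] at hbernoulli
  rwa [add_div, div_self hm'.ne']

theorem sub_inv_le_two (hm : 0 < m) : ((m + 1) / m - ((m + 1) / m : ℝ)⁻¹) ≤ 2 := by
  have hm' : (1 : ℝ) ≤ m := by exact_mod_cast hm
  have hle : ((m + 1) / m : ℝ) ≤ 2 := (div_le_iff₀ (by positivity)).2 (by linarith)
  have hinv : (0 : ℝ) ≤ ((m + 1) / m : ℝ)⁻¹ := by positivity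
  linarith

theorem two_mul_card_add_drift_le (hm : 0 < m) (hn : n ≤ 2 ^ m) :
    2 * ((2 * m + 1) * 2 ^ m) + n * ((m + 1) / m - ((m + 1) / m : ℝ)⁻¹) ≤ 6 * (2 ^ m) ^ 2 := by
  have hm2 : (m : ℝ) + 1 ≤ 2 ^ m := by exact_mod_cast (Nat.lt_two_pow_self (n := m))
  have hn2 : (n : ℝ) ≤ 2 ^ m := by exact_mod_cast hn
  have hpath : n * ((m + 1) / m - ((m + 1) / m : ℝ)⁻¹) ≤ 2 ^ m * 2 :=
    (mul_le_mul_of_nonneg_left (sub_inv_le_two hm) n.cast_nonneg).trans (by gcongr)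
  nlinarith

theorem uniformPoints_lt_abs_run_le (hm : 0 < m) (hn : n ≤ 2 ^ m) (k : ℕ) :
    uniformPoints n {p | ∃ v, ((m * (m * (k + 6)) : ℕ) : ℤ) <
      |Greedy.run (Haar.gridHaar m) ((m + 1) / m) 0 (List.ofFn fun t => cell m (p t)) v|} ≤
      ENNReal.ofReal (6 / (2 ^ m) ^ (k + 4)) := by
  classical
  have : (1 : ℝ) ≤ m := by exact_mod_cast hm
  have hr : 1 < ((m + 1) / m : ℝ) := (one_lt_div (by positivity)).2 (by linarith)
  have hN : ((2 * m + 1 : ℕ) : ℝ) * ((m + 1) / m - 1) ≤ (m + 1) / m + 1 := by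
    push_cast
    apply le_of_eq
    field_simp
    ring
  have hpow : ((2 : ℝ) ^ m) ^ (k + 6) ≤ ((m + 1) / m) ^ (m * (m * (k + 6))) := by
    rw [pow_mul _ m, ← pow_mul]
    gcongr
    exact two_le_add_one_div_pow hm
  let bad : Finset (Fin n → Fin (2 ^ m) × Fin (2 ^ m)) := {c | ∃ v,
    ((m * (m * (k + 6)) : ℕ) : ℤ) <
      |Greedy.run (Haar.gridHaar m) ((m + 1) / m) 0 (List.ofFn c) v|}
  have hcard : (bad.card : ℝ) * _ ≤ _ := Greedy.card_exists_lt_abs_run_mul_pow_le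
    (Haar.isSparseOrthogonal_gridHaar m) hr hN n (m * (m * (k + 6)))
  rw [Haar.card_block, Fintype.card_prod, Fintype.card_fin] at hcard
  push_cast at hcard
  suffices hbad : (bad.card : ℝ) ≤ (2 ^ m * 2 ^ m) ^ n * (6 / (2 ^ m) ^ (k + 4)) by
    simpa [bad] using uniformPoints_cell_mem_le hbad
  rw [mul_div_assoc', le_div_iff₀ (by positivity)]
  refine le_of_mul_le_mul_right ?_ (by positivity : (0 : ℝ) < (2 ^ m) ^ 2)
  calc (bad.card : ℝ) * (2 ^ m) ^ (k + 4) * (2 ^ m) ^ 2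
    _ = bad.card * (2 ^ m) ^ (k + 6) := by ring
    _ ≤ bad.card * ((m + 1) / m : ℝ) ^ (m * (m * (k + 6))) := by gcongr
    _ ≤ _ := hcard
    _ ≤ (2 ^ m * 2 ^ m) ^ n * (6 * (2 ^ m) ^ 2) := by
        gcongr
        exact two_mul_card_add_drift_le hm hn
    _ = (2 ^ m * 2 ^ m) ^ n * 6 * (2 ^ m) ^ 2 := by ring

theorem card_filter_fst_eq {α β : Type*} [Fintype α] [Fintype β] [DecidableEq α] (a : α) :
    ({z | z.1 = a} : Finset (α × β)).card = Fintype.card β := by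
  have hset : ({z | z.1 = a} : Finset (α × β)) = {a} ×ˢ Finset.univ := by
    ext ⟨_, _⟩
    simp [eq_comm]
  rw [hset, Finset.card_product, Finset.card_singleton, one_mul, Finset.card_univ]

theorem card_filter_snd_eq {α β : Type*} [Fintype α] [Fintype β] [DecidableEq β] (b : β) :
    ({z | z.2 = b} : Finset (α × β)).card = Fintype.card α := by
  have hset : ({z | z.2 = b} : Finset (α × β)) = Finset.univ ×ˢ {b} := by
    ext ⟨_, _⟩
    simp [eq_comm]
  rw [hset, Finset.card_product, Finset.card_singleton, mul_one, Finset.card_univ]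

theorem uniformPoints_le_card_fiber_le (hn : n ≤ 2 ^ m) (k : ℕ)
    {f : Fin (2 ^ m) × Fin (2 ^ m) → Fin (2 ^ m)}
    (hf : ∀ u, ({z | f z = u} : Finset (Fin (2 ^ m) × Fin (2 ^ m))).card = 2 ^ m) :
    uniformPoints n {p | ∃ u, m * (k + 5) ≤
      ({t | f (cell m (p t)) = u} : Finset (Fin n)).card} ≤
      ENNReal.ofReal (3 / (2 ^ m) ^ (k + 4)) := by
  let bad : Finset (Fin n → Fin (2 ^ m) × Fin (2 ^ m)) :=
    {c | ∃ u, m * (k + 5) ≤ ({t | f (c t) = u} : Finset (Fin n)).card}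
  have hcard : bad.card * 2 ^ (m * (k + 5)) ≤ 3 * 2 ^ m * (2 ^ m * 2 ^ m) ^ n := by
    have h := card_exists_le_card_fiber_mul_two_pow_le (n := n) (m * (k + 5)) f
      (fun u => by rw [hf, Fintype.card_prod, Fintype.card_fin]) (by rwa [Fintype.card_fin])
    rw [Fintype.card_prod, Fintype.card_fin] at h
    convert h
  suffices hbad : (bad.card : ℝ) ≤ (2 ^ m * 2 ^ m) ^ n * (3 / (2 ^ m) ^ (k + 4)) by
    simpa [bad] using uniformPoints_cell_mem_le hbad
  rw [mul_div_assoc', le_div_iff₀ (by positivity)]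
  refine le_of_mul_le_mul_right ?_ (by positivity : (0 : ℝ) < 2 ^ m)
  calc (bad.card : ℝ) * (2 ^ m) ^ (k + 4) * 2 ^ m
    _ = bad.card * 2 ^ (m * (k + 5)) := by ring
    _ ≤ 3 * 2 ^ m * (2 ^ m * 2 ^ m) ^ n := by exact_mod_cast hcard
    _ = (2 ^ m * 2 ^ m) ^ n * 3 * 2 ^ m := by ring

theorem abs_color (A : OnlineAlg) (p : Fin n → ℝ × ℝ) (t : Fin n) : |A.color p t| = 1 := by
  unfold OnlineAlg.color
  split_ifs <;> rfl

theorem twelve_div_pow_le (hn : 2 ≤ n) (hnm : n ≤ 2 ^ m) (k : ℕ) :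
    (12 : ℝ) / (2 ^ m) ^ (k + 4) ≤ 1 / (n : ℝ) ^ k := by
  have hwidth : (2 : ℝ) ≤ 2 ^ m := by exact_mod_cast hn.trans hnm
  calc (12 : ℝ) / (2 ^ m) ^ (k + 4) = 12 / ((2 ^ m) ^ k * (2 ^ m) ^ 4) := by ring
    _ ≤ 16 / ((2 ^ m) ^ k * 2 ^ 4) := by gcongr; norm_num
    _ = 1 / (2 ^ m) ^ k := by ring
    _ ≤ 1 / (n : ℝ) ^ k := by
      gcongr
      exact_mod_cast hnm

namespace StripeAlg

theorem stripeDisc_color_le (hn : 2 ≤ n) (k : ℕ) {p : Fin n → ℝ × ℝ}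
    (hp : ∀ t, p t ∈ Ico (0 : ℝ) 1 ×ˢ Ico (0 : ℝ) 1) :
    let m := Nat.clog 2 n
    (∀ v, |Greedy.run (Haar.gridHaar m) ((m + 1) / m) 0 (List.ofFn fun t => cell m (p t)) v| ≤
      ((m * (m * (k + 6)) : ℕ) : ℤ)) →
    (∀ u, ({t | (cell m (p t)).1 = u} : Finset (Fin n)).card ≤ m * (k + 5)) →
    (∀ u, ({t | (cell m (p t)).2 = u} : Finset (Fin n)).card ≤ m * (k + 5)) →
    stripeDisc p (alg.color p) ≤ 6 * (k + 6) * (m : ℝ) ^ 3 := by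
  intro m hrun hX hY
  have hm : (1 : ℝ) ≤ m := by exact_mod_cast Nat.clog_pos one_lt_two hn
  have hdisc := stripeDisc_le (fun t => (abs_color alg p t).le) hp
    (fun v => (sum_color_mul_gridHaar hn hp v).symm ▸ hrun v) hX hY
  push_cast at hdisc
  calc stripeDisc p (alg.color p) ≤ _ := hdisc
    _ ≤ 2 * (m + 1) * (m * (m * (k + 6))) + 2 * (m * (k + 6)) := by gcongr; norm_num
    _ = (k + 6) * (2 * (m : ℝ) ^ 3 + 2 * m ^ 2 + 2 * m ^ 1) := by ring
    _ ≤ (k + 6) * (2 * (m : ℝ) ^ 3 + 2 * m ^ 3 + 2 * m ^ 3) := by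
        gcongr <;> first | exact hm | norm_num
    _ = _ := by ring

theorem uniformPoints_lt_stripeDisc_le (hn : 2 ≤ n) (k : ℕ) :
    uniformPoints n {p | 6 * (k + 6) * (Nat.clog 2 n : ℝ) ^ 3 < stripeDisc p (alg.color p)} ≤
      ENNReal.ofReal (1 / (n : ℝ) ^ k) := by
  set m := Nat.clog 2 n
  have hm : 0 < m := Nat.clog_pos one_lt_two hn
  have hnm : n ≤ 2 ^ m := Nat.le_pow_clog one_lt_two n
  let drifted : Set (Fin n → ℝ × ℝ) := {p | ∃ v, ((m * (m * (k + 6)) : ℕ) : ℤ) <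
    |Greedy.run (Haar.gridHaar m) ((m + 1) / m) 0 (List.ofFn fun t => cell m (p t)) v|}
  let crowded (f : Fin (2 ^ m) × Fin (2 ^ m) → Fin (2 ^ m)) : Set (Fin n → ℝ × ℝ) :=
    {p | ∃ u, m * (k + 5) ≤ ({t | f (cell m (p t)) = u} : Finset (Fin n)).card}
  have hdrifted := uniformPoints_lt_abs_run_le hm hnm k
  have hX : uniformPoints n (crowded Prod.fst) ≤ _ :=
    uniformPoints_le_card_fiber_le hnm k fun u =>
      (card_filter_fst_eq u).trans (Fintype.card_fin _)
  have hY : uniformPoints n (crowded Prod.snd) ≤ _ :=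
    uniformPoints_le_card_fiber_le hnm k fun u =>
      (card_filter_snd_eq u).trans (Fintype.card_fin _)
  have hsubset : {p | 6 * (k + 6) * (m : ℝ) ^ 3 < stripeDisc p (alg.color p)}
      ≤ᵐ[uniformPoints n] (drifted ∪ (crowded Prod.fst ∪ crowded Prod.snd) : Set _) := by
    filter_upwards [ae_mem_Ico n] with p hp hdisc
    by_contra hgood
    change p ∉ drifted ∪ (crowded Prod.fst ∪ crowded Prod.snd) at hgood
    simp only [drifted, crowded, mem_union, mem_ofPred_eq, not_or, not_exists, not_lt, not_le]
      at hgood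
    obtain ⟨hrun, hX, hY⟩ := hgood
    exact hdisc.not_ge (stripeDisc_color_le hn k hp hrun (fun u => (hX u).le) fun u => (hY u).le)
  calc _ ≤ uniformPoints n (drifted ∪ (crowded Prod.fst ∪ crowded Prod.snd)) :=
        measure_mono_ae hsubset
    _ ≤ ENNReal.ofReal (6 / (2 ^ m) ^ (k + 4)) +
        (ENNReal.ofReal (3 / (2 ^ m) ^ (k + 4)) + ENNReal.ofReal (3 / (2 ^ m) ^ (k + 4))) :=
        (measure_union_le _ _).trans (add_le_add hdrifted
          ((measure_union_le _ _).trans (add_le_add hX hY)))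
    _ = ENNReal.ofReal (12 / (2 ^ m) ^ (k + 4)) := by
        rw [← ENNReal.ofReal_add (by positivity) (by positivity),
          ← ENNReal.ofReal_add (by positivity) (by positivity)]
        congr 1
        ring
    _ ≤ ENNReal.ofReal (1 / (n : ℝ) ^ k) :=
        ENNReal.ofReal_le_ofReal (twelve_div_pow_le hn hnm k)

end StripeAlg

end Tail

section Asymptotics

theorem log_pow_three_le_rpow {x : ℝ} (hx : Real.exp 1 < x) :
    Real.log x ^ 3 ≤ x ^ (12 / Real.log (Real.log x)) := by
  have hx₀ : 0 < x := (Real.exp_pos 1).trans hx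
  set y := Real.log x
  have hy : 1 < y := (Real.lt_log_iff_exp_lt hx₀).2 hx
  have hlog : Real.log y ≤ 2 * √y := by
    have hsqrt := Real.log_le_sub_one_of_pos (Real.sqrt_pos.2 (by linarith : 0 < y))
    rw [Real.log_sqrt (by linarith)] at hsqrt
    linarith
  have hexp : y ^ 3 = Real.exp (3 * Real.log y) := by
    rw [mul_comm, Real.exp_mul, Real.exp_log (by linarith)]
    norm_cast
  rw [Real.rpow_def_of_pos hx₀, hexp, Real.exp_le_exp, mul_div_assoc',
    le_div_iff₀ (Real.log_pos hy)]
  calc 3 * Real.log y * Real.log y = 3 * Real.log y ^ 2 := by ring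
    _ ≤ 3 * (2 * √y) ^ 2 := by
      gcongr
      exact (Real.log_pos hy).le
    _ = y * 12 := by
      rw [mul_pow, Real.sq_sqrt (by linarith)]
      ring

theorem clog_two_le_three_mul_log {n : ℕ} (hn : 2 ≤ n) :
    (Nat.clog 2 n : ℝ) ≤ 3 * Real.log n := by
  have hpow : (2 : ℝ) ^ (Nat.clog 2 n - 1) ≤ n := by
    exact_mod_cast (Nat.pow_pred_clog_lt_self one_lt_two hn).le
  have hlog := Real.log_le_log (by positivity) hpow
  rw [Real.log_pow, Nat.cast_sub (Nat.clog_pos one_lt_two hn), Nat.cast_one] at hlog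
  have hlog₂ : Real.log 2 ≤ Real.log n := Real.log_le_log two_pos (by exact_mod_cast hn)
  nlinarith [Real.log_two_gt_d9]

end Asymptotics

theorem theorem2_general :
    ∃ A : OnlineAlg, A.IsPolyTime ∧ ∀ k : ℕ, ∃ C : ℝ, 0 < C ∧ ∀ n : ℕ, 2 ≤ n →
      uniformPoints n {p | C * Real.log n ^ 3 < stripeDisc p (A.color p)} ≤
        ENNReal.ofReal (1 / (n : ℝ) ^ k) := by
  refine ⟨StripeAlg.alg, StripeAlg.isPolyTime_alg, fun k =>
    ⟨6 * (k + 6) * 27, by positivity, fun n hn => ?_⟩⟩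
  refine (measure_mono fun p hp => ?_).trans
    (StripeAlg.uniformPoints_lt_stripeDisc_le hn k)
  calc 6 * (k + 6) * (Nat.clog 2 n : ℝ) ^ 3 ≤ 6 * (k + 6) * (3 * Real.log n) ^ 3 := by
        gcongr
        exact clog_two_le_three_mul_log hn
    _ = 6 * (k + 6) * 27 * Real.log n ^ 3 := by ring
    _ < stripeDisc p (StripeAlg.alg.color p) := hp

theorem theorem2 :
    ∃ A : OnlineAlg, A.IsPolyTime ∧
      ∃ c : ℝ, 0 < c ∧ ∀ k : ℕ, ∃ C : ℝ, 0 < C ∧ ∀ n : ℕ, 3 ≤ n →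
        uniformPoints n
            {p | C * (n : ℝ) ^ (c / Real.log (Real.log n)) < stripeDisc p (A.color p)} ≤
          ENNReal.ofReal (1 / (n : ℝ) ^ k) := by
  obtain ⟨A, hA, hdisc⟩ := theorem2_general
  refine ⟨A, hA, 12, by norm_num, fun k => (hdisc k).imp fun C ⟨hC, h⟩ => ⟨hC, fun n hn => ?_⟩⟩
  have hexp : Real.exp 1 < n := Real.exp_one_lt_three.trans_le (by exact_mod_cast hn)
  refine (measure_mono fun p hp => ?_).trans (h n (by omega))
  exact lt_of_le_of_lt (mul_le_mul_of_nonneg_left (log_pow_three_le_rpow hexp) hC.le) hp
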